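/- For every $n\ge 0$ let $(p_{n,k})_{k\ge 1}$ be nonnegative reals with $\sum_{k\ge1}p_{n,k}=1$ and $\sum_{k\ge1}k\,p_{n,k}<\infty$, and for $n\ge 0$, $k\ge 1$ let $G_{n,k}$ be a probability law on $\mathbb{R}^k$. Consider the generalized branching random walk governed by these data: at time $0$ there is one particle, located at $0$; a particle $v$ alive at time $n$ and located at $S_v$ dies at time $n+1$ and has $K_v\ge 1$ children, located at $S_v+X_{v,1},\dots,S_v+X_{v,K_v}$, where the vectors $(K_v,X_{v,1},\dots,X_{v,K_v})$ of the different particles are independent, $P(K_v=k)=p_{n,k}$, and given $K_v=k$ the vector $(X_{v,1},\dots,X_{v,k})$ has law $G_{n,k}$. Let $\mathcal M_n$ be the maximum of $S_v$ over the particles $v$ alive at time $n$, let $F_n$ be the law of $\mathcal M_n$, and let $\mathrm{Med}(F_n)$ be a median of $F_n$. Let $g_{n,k}$ be the common one-dimensional marginal distribution function of $G_{n,k}$ (if the $k$ marginals differ, let $g_{n,k}$ be their average, that is, the marginal of $G_{n,k}$ symmetrized over permutations of the coordinates), and let $\bar g_{n,k}=1-g_{n,k}$. Assume: - (B1) there is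 an integer $k_0>1$ such that $p_{n,k}=0$ for all $n$ and all $k\notin\{1,\dots,k_0\}$; - (B2) there is a real number $m_0>1$ such that $\inf_n\sum_{k=1}^{k_0}k\,p_{n,k}>m_0$; and, with all constants uniform over the pairs $(n,k)$ with $p_{n,k}\ne 0$: - (MT1) for some $\epsilon_0<\min\{\tfrac14\log m_0,\,1\}$ there is an $x_0\in\mathbb{R}$ such that $\bar g_{n,k}(x_0)\ge 1-\epsilon_0$; - (MT2) there are $a>0$ and $M_0>0$ such that $\bar g_{n,k}(x+M)\le e^{-aM}\bar g_{n,k}(x)$ for all $M>M_0$ and $x\ge 0$; - (GT) for every $\eta>0$ there is a $B>0$ such that $G_{n,k}((-\infty,B]^k)\ge 1-\eta$ and $G_{n,k}([-B,\infty)^k)\ge 1-\eta$. Then the family of the recentered laws of the maximum, i.e. of the laws of $\mathcal M_n-\mathrm{Med}(F_n)$, $n\ge 0$, is tight. -/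

import Mathlib

open MeasureTheory ProbabilityTheory

noncomputable section

namespace GBRW

/-- What one particle leaves behind: its number `k` of children, together with the vector
`(x₀, …, x_{k-1})` of their displacements relative to the parent. -/
abbrev Offspring : Type := Σ k : ℕ, (Fin k → ℝ)

/-- Displacement of the `i`-th child (children are numbered from `0`); the value for a child that
does not exist is irrelevant and set to `0`. -/
def displacement (o : Offspring) (i : ℕ) : ℝ :=
  if h : i < o.1 then o.2 ⟨i, h⟩ else 0

/-- The joint law of `(K, X₁, …, X_K)`: `K = k` with probability `p k`, and given `K = k` the vector
`(X₁, …, X_k)` has law `G k`. -/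
def offspringLaw (p : ℕ → ℝ) (G : (k : ℕ) → Measure (Fin k → ℝ)) : Measure Offspring :=
  Measure.sum fun k => ENNReal.ofReal (p k) • (G k).map fun x => (⟨k, x⟩ : Offspring)

/-- Branching rules: for every time `n`, `(p n k)_{k ≥ 1}` is a probability distribution with
finite mean. -/
structure IsBranchingRule (p : ℕ → ℕ → ℝ) : Prop where
  nonneg : ∀ n k, 0 ≤ p n k
  zero : ∀ n, p n 0 = 0
  hasSum : ∀ n, HasSum (p n) 1
  summable_mean : ∀ n, Summable fun k : ℕ => (k : ℝ) * p n k

/-! Particles are words over `ℕ` (Ulam–Harris labels): `[]` is the root and `i :: v` is the `i`-th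
child of `v`, so that the length of a word is the generation of the particle. A realisation of the
walk is a map `c : List ℕ → Offspring`; only its values at particles that are born matter. -/

/-- The particle with the given label is born. -/
def IsBorn (c : List ℕ → Offspring) : List ℕ → Prop
  | [] => True
  | i :: v => IsBorn c v ∧ i < (c v).1

/-- Location `S_v` of a particle. -/
def location (c : List ℕ → Offspring) : List ℕ → ℝ
  | [] => 0
  | i :: v => location c v + displacement (c v) i

/-- The set `D_n` of the particles alive at time `n`. -/
def generation (c : List ℕ → Offspring) (n : ℕ) : Set (List ℕ) :=
  {v | v.length = n ∧ IsBorn c v}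

/-- The maximal displacement `max_{v ∈ D_n} S_v` at time `n`. The set `D_n` is always finite, and it
is non-empty as soon as every particle has at least one child. -/
def maxLocation (c : List ℕ → Offspring) (n : ℕ) : ℝ :=
  sSup (location c '' generation c n)

/-- `ξ` is a generalized branching random walk on the probability space `(Ω, P)`, with branching
rules `p` and displacement laws `G`: the offspring vectors of the particles are independent, and
that of a particle of generation `n` is governed by `p n` and `G n`. -/
structure IsGBRW (p : ℕ → ℕ → ℝ) (G : (n k : ℕ) → Measure (Fin k → ℝ))
    {Ω : Type*} [MeasurableSpace Ω] (P : Measure Ω) (ξ : List ℕ → Ω → Offspring) : Prop where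
  measurable : ∀ v, Measurable (ξ v)
  indep : iIndepFun ξ P
  law : ∀ v, P.map (ξ v) = offspringLaw (p v.length) (G v.length)

/-- The law `F_n` of the maximal displacement at time `n`. -/
def maxLaw {Ω : Type*} [MeasurableSpace Ω] (P : Measure Ω) (ξ : List ℕ → Ω → Offspring) (n : ℕ) :
    Measure ℝ :=
  P.map fun ω => maxLocation (fun v => ξ v ω) n

/-- `m` is a median of the probability measure `μ`. -/
def IsMedian (μ : Measure ℝ) (m : ℝ) : Prop :=
  1 / 2 ≤ μ (Set.Iic m) ∧ 1 / 2 ≤ μ (Set.Ici m)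

/-- The one-dimensional marginal distribution function of a law on `ℝ^k`: the average over `i` of
the distribution functions of the `k` coordinates. It is the common marginal if the coordinates have
the same law, and in general the marginal of the law symmetrised over permutations of the
coordinates. -/
def marginalCDF {k : ℕ} (μ : Measure (Fin k → ℝ)) (x : ℝ) : ℝ :=
  (∑ i : Fin k, μ.real {y | y i ≤ x}) / k

/-- The right tail of the marginal distribution. -/
def marginalTail {k : ℕ} (μ : Measure (Fin k → ℝ)) (x : ℝ) : ℝ :=
  1 - marginalCDF μ x

/-! The maximal displacement is a random variable, so `maxLaw` is a genuine law. -/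

lemma finite_generation (c : List ℕ → Offspring) (n : ℕ) : (generation c n).Finite := by
  induction n with
  | zero =>
    refine (Set.finite_singleton ([] : List ℕ)).subset ?_
    rintro v ⟨hv, -⟩
    simpa using hv
  | succ n ih =>
    refine (ih.biUnion fun v _ => (Set.finite_Iio (c v).1).image (fun i => i :: v)).subset ?_
    rintro (_ | ⟨i, v⟩) ⟨hl, hb⟩
    · simp at hl
    · simp only [Set.mem_iUnion]
      exact ⟨v, ⟨by simpa using hl, hb.1⟩, i, hb.2, rfl⟩

lemma measurable_of_forall_sigmaMk {β : Type*} [MeasurableSpace β] {f : Offspring → β}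
    (h : ∀ k, Measurable fun x : Fin k → ℝ => f ⟨k, x⟩) : Measurable f := by
  intro s hs
  rw [MeasurableSpace.measurableSet_iInf]
  exact fun k => h k hs

lemma measurable_displacement (i : ℕ) : Measurable fun o : Offspring => displacement o i := by
  refine measurable_of_forall_sigmaMk fun k => ?_
  by_cases h : i < k
  · simpa [displacement, h] using measurable_pi_apply (⟨i, h⟩ : Fin k)
  · simp [displacement, h]

lemma measurable_numChildren : Measurable fun o : Offspring => o.1 :=
  measurable_of_forall_sigmaMk fun _ => measurable_const

lemma measurable_location (v : List ℕ) : Measurable fun c => location c v := by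
  induction v with
  | nil => exact measurable_const
  | cons i v ih => exact ih.add ((measurable_displacement i).comp (measurable_pi_apply v))

lemma measurableSet_isBorn (v : List ℕ) : MeasurableSet {c | IsBorn c v} := by
  induction v with
  | nil => simp [IsBorn]
  | cons i v ih =>
    exact ih.inter (measurableSet_lt measurable_const
      (measurable_numChildren.comp (measurable_pi_apply v)))

lemma measurable_maxLocation (n : ℕ) : Measurable fun c => maxLocation c n := by
  classical
  have key : (fun c => maxLocation c n) = fun c =>
      (⨆ v : List ℕ, if v ∈ generation c n then ((location c v : ℝ) : EReal) else ⊥).toReal := by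
    funext c
    rcases (generation c n).eq_empty_or_nonempty with h | h
    · simp [maxLocation, h]
    · obtain ⟨w, hw, hmax⟩ := Set.exists_max_image _ (location c) (finite_generation c n) h
      have h1 : maxLocation c n = location c w :=
        IsGreatest.csSup_eq ⟨⟨w, hw, rfl⟩, by rintro _ ⟨v, hv, rfl⟩; exact hmax v hv⟩
      have h2 : (⨆ v : List ℕ, if v ∈ generation c n then ((location c v : ℝ) : EReal) else ⊥)
          = ((location c w : ℝ) : EReal) := by
        refine le_antisymm (iSup_le fun v => ?_) (le_iSup_of_le w (by simp [hw]))
        split_ifs with hv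
        · exact_mod_cast hmax v hv
        · exact bot_le
      rw [h1, h2, EReal.toReal_coe]
  rw [key]
  refine measurable_ereal_toReal.comp (Measurable.iSup fun v => ?_)
  refine Measurable.ite ?_ (measurable_coe_real_ereal.comp (measurable_location v)) measurable_const
  by_cases hv : v.length = n
  · simpa [generation, hv] using measurableSet_isBorn v
  · simp [generation, hv]

end GBRW

end

/-! Write u_n(x) = P(M_n > x). Splitting at the root gives u_{n+1} = `step μ u`, where u is the
n-generation tail started one time unit later (`measure_below`). Tightness thus becomes a property
of iterates of a nonlinear operator on tails.

Right side: where u_n is small it decays exponentially, uniformly in n. The invariant is u(x)(1 + ε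
- C u(x)) ≤ u(x - M), with ε = s/8, and `RatioBound.step` propagates it. Let ω be the new tail at x.
If Cω ≥ s/8, monotonicity suffices; if the new tail at x - M is at least (1 + s/8)ω, nothing is left
to prove. Otherwise the new tail is nearly flat on [x - M, x]. As branching multiplies small tails
by nearly 1 + s, the old tail at x - M/2 is then at most (1 - s/8)ω. This contracts the quadratic
error of the invariant and makes room for the second-order error of branching. Only displacements
beyond M/2 escape the contraction, and the exponential tail of the intensity controls them
(`le_integral_damp_of_ratio`).

Left side: once the tail exceeds a fixed level δ, logistic growth brings it close to 1 within J
generations, J not depending on n (`le_maxTail_sub`). Meanwhile the tail further right grows by at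
most k₀^J, up to small errors (`maxTail_add_le`), which the exponential decay absorbs. So the tail
falls from near 1 to near 0 in a window of bounded width (`exists_window`), which must contain the
median. -/

noncomputable section

namespace GBRW

/-! ### Second-order bounds for 1 - ∏ (1 - tᵢ). -/

section Elementary

variable {ι : Type*}

lemma prod_one_sub_mem_Icc (s : Finset ι) {f : ι → ℝ} (h0 : ∀ i ∈ s, 0 ≤ f i)
    (h1 : ∀ i ∈ s, f i ≤ 1) : ∏ i ∈ s, (1 - f i) ∈ Set.Icc (0 : ℝ) 1 :=
  ⟨Finset.prod_nonneg fun i hi => by linarith [h1 i hi],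
    Finset.prod_le_one (fun i hi => by linarith [h1 i hi]) fun i hi => by linarith [h0 i hi]⟩

lemma one_sub_prod_one_sub_le_sum (s : Finset ι) {f : ι → ℝ} (h0 : ∀ i ∈ s, 0 ≤ f i)
    (h1 : ∀ i ∈ s, f i ≤ 1) : 1 - ∏ i ∈ s, (1 - f i) ≤ ∑ i ∈ s, f i := by
  classical
  induction s using Finset.induction_on with
  | empty => simp
  | insert a s ha ih =>
    rw [Finset.prod_insert ha, Finset.sum_insert ha]
    have h0' : ∀ i ∈ s, 0 ≤ f i := fun i hi => h0 i (Finset.mem_insert_of_mem hi)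
    have h1' : ∀ i ∈ s, f i ≤ 1 := fun i hi => h1 i (Finset.mem_insert_of_mem hi)
    have := ih h0' h1'
    obtain ⟨hp0, hp1⟩ := prod_one_sub_mem_Icc s h0' h1'
    have ha0 := h0 a (Finset.mem_insert_self a s)
    nlinarith

lemma prod_one_sub_le (s : Finset ι) {f : ι → ℝ} (h0 : ∀ i ∈ s, 0 ≤ f i)
    (h1 : ∀ i ∈ s, f i ≤ 1) :
    ∏ i ∈ s, (1 - f i) ≤ 1 - ∑ i ∈ s, f i + (∑ i ∈ s, f i) ^ 2 / 2 := by
  classical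
  induction s using Finset.induction_on with
  | empty => simp
  | insert a s ha ih =>
    rw [Finset.prod_insert ha, Finset.sum_insert ha]
    have := ih (fun i hi => h0 i (Finset.mem_insert_of_mem hi))
      (fun i hi => h1 i (Finset.mem_insert_of_mem hi))
    have ha0 := h0 a (Finset.mem_insert_self a s)
    have ha1 := h1 a (Finset.mem_insert_self a s)
    have := mul_le_mul_of_nonneg_left this (sub_nonneg.2 ha1)
    nlinarith [mul_nonneg ha0 (sq_nonneg (∑ i ∈ s, f i)), sq_nonneg (f a)]

/-- A concave minorant of the identity which controls the second-order terms of
`1 - ∏ (1 - tᵢ)`. -/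
def damp (κ t : ℝ) : ℝ := min t (1 / κ) - κ / 2 * min t (1 / κ) ^ 2

/-- The parabola t - κt²/2 has its vertex at 1/κ, exactly where `damp` freezes it. -/
lemma damp_mono {κ : ℝ} (hκ : 0 < κ) : Monotone (damp κ) := by
  intro s t hst
  have h1 : min s (1 / κ) ≤ min t (1 / κ) := min_le_min_right _ hst
  have h2 : κ * min t (1 / κ) ≤ 1 := by
    have := mul_le_mul_of_nonneg_left (min_le_right t (1 / κ)) hκ.le
    rwa [mul_one_div_cancel hκ.ne'] at this
  unfold damp
  generalize min s (1 / κ) = x at *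
  generalize min t (1 / κ) = y at *
  nlinarith [mul_nonneg (sub_nonneg.2 h1) hκ.le]

lemma sub_sq_le_damp {κ t : ℝ} (hκ : 0 < κ) : t - κ / 2 * t ^ 2 ≤ damp κ t := by
  unfold damp
  rcases le_total t (1 / κ) with h | h
  · rw [min_eq_left h]
  · rw [min_eq_right h]
    have : t = 1 / κ + (t - 1 / κ) := by ring
    generalize t - 1 / κ = d at this
    have e : κ * (1 / κ) = 1 := mul_one_div_cancel hκ.ne'
    generalize 1 / κ = r at *
    subst this
    nlinarith [mul_nonneg hκ.le (sq_nonneg d)]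

lemma div_le_damp {κ t : ℝ} (hκ : 1 ≤ κ) (h0 : 0 ≤ t) (h1 : t ≤ 1) : t / (2 * κ) ≤ damp κ t := by
  have hκ0 : 0 < κ := by linarith
  have e : κ * (1 / κ) = 1 := mul_one_div_cancel hκ0.ne'
  have e2 : t / (2 * κ) = t * (1 / κ) / 2 := by field_simp
  have hr : 1 / κ ≤ 1 := by rw [div_le_one hκ0]; exact hκ
  have hr0 : 0 < 1 / κ := by positivity
  rw [e2]
  unfold damp
  rcases le_total t (1 / κ) with h | h
  · rw [min_eq_left h]
    generalize 1 / κ = r at *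
    nlinarith [mul_nonneg h0 (sub_nonneg.2 h), mul_nonneg (mul_nonneg hκ0.le h0) (sub_nonneg.2 h)]
  · rw [min_eq_right h]
    generalize 1 / κ = r at *
    nlinarith

/-- Truncating each f i at 1/κ only increases the product. Cauchy–Schwarz with at most κ terms then
replaces the square of the sum by κ times the sum of squares, which decouples the indices. -/
lemma sum_damp_le (s : Finset ι) {f : ι → ℝ} {κ : ℝ} (hκ : 1 ≤ κ) (hs : (s.card : ℝ) ≤ κ)
    (h0 : ∀ i ∈ s, 0 ≤ f i) (h1 : ∀ i ∈ s, f i ≤ 1) :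
    ∑ i ∈ s, damp κ (f i) ≤ 1 - ∏ i ∈ s, (1 - f i) := by
  have hκ0 : 0 < κ := by linarith
  have g0 : ∀ i ∈ s, 0 ≤ min (f i) (1 / κ) := fun i hi => le_min (h0 i hi) (by positivity)
  have g1 : ∀ i ∈ s, min (f i) (1 / κ) ≤ 1 := fun i hi => (min_le_left _ _).trans (h1 i hi)
  have hle : ∏ i ∈ s, (1 - f i) ≤ ∏ i ∈ s, (1 - min (f i) (1 / κ)) :=
    Finset.prod_le_prod (fun i hi => by linarith [h1 i hi])
      fun i _ => by linarith [min_le_left (f i) (1 / κ)]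
  have hq := prod_one_sub_le s g0 g1
  have hcs : (∑ i ∈ s, min (f i) (1 / κ)) ^ 2 ≤ s.card * ∑ i ∈ s, min (f i) (1 / κ) ^ 2 :=
    sq_sum_le_card_mul_sum_sq
  have h2 : (s.card : ℝ) * ∑ i ∈ s, min (f i) (1 / κ) ^ 2 ≤ κ * ∑ i ∈ s, min (f i) (1 / κ) ^ 2 :=
    mul_le_mul_of_nonneg_right hs (Finset.sum_nonneg fun i _ => sq_nonneg _)
  simp only [damp, Finset.sum_sub_distrib, ← Finset.mul_sum]
  linarith

end Elementary

/-! ### The one-generation operator and its comparison with the intensity measure. -/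

/-- The tail at `x` of the maximum over the first generation of `displacement + Mᵢ`, where the `Mᵢ`
are independent with tail `u`. -/
def step (μ : Measure Offspring) (u : ℝ → ℝ) (x : ℝ) : ℝ :=
  ∫ o, (1 - ∏ i ∈ Finset.range o.1, (1 - u (x - displacement o i))) ∂μ

/-- A nonincreasing function with values in `[0, 1]`. -/
structure IsTail (u : ℝ → ℝ) : Prop where
  anti : Antitone u
  nonneg : ∀ x, 0 ≤ u x
  le_one : ∀ x, u x ≤ 1

lemma measurable_sigmaMk (k : ℕ) : Measurable fun x : Fin k → ℝ => (⟨k, x⟩ : Offspring) := by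
  intro s hs
  rw [MeasurableSpace.measurableSet_iInf] at hs
  exact hs k

lemma measurable_sum_range {f : ℕ → Offspring → ℝ} (hf : ∀ i, Measurable (f i)) :
    Measurable fun o : Offspring => ∑ i ∈ Finset.range o.1, f i o :=
  measurable_of_forall_sigmaMk fun k => Finset.measurable_fun_sum (Finset.range k)
    (f := fun i (x : Fin k → ℝ) => f i ⟨k, x⟩) fun i _ => (hf i).comp (measurable_sigmaMk k)

lemma measurable_prod_range {f : ℕ → Offspring → ℝ} (hf : ∀ i, Measurable (f i)) :
    Measurable fun o : Offspring => ∏ i ∈ Finset.range o.1, f i o :=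
  measurable_of_forall_sigmaMk fun k => Finset.measurable_fun_prod (Finset.range k)
    (f := fun i (x : Fin k → ℝ) => f i ⟨k, x⟩) fun i _ => (hf i).comp (measurable_sigmaMk k)

lemma IsTail.measurable {u : ℝ → ℝ} (hu : IsTail u) : Measurable u := hu.anti.measurable

/-- The integrand of `step`. -/
def hit (u : ℝ → ℝ) (x : ℝ) (o : Offspring) : ℝ :=
  1 - ∏ i ∈ Finset.range o.1, (1 - u (x - displacement o i))

lemma measurable_hit {u : ℝ → ℝ} (hu : IsTail u) (x : ℝ) : Measurable (hit u x) :=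
  measurable_const.sub (measurable_prod_range fun i =>
    measurable_const.sub (hu.measurable.comp (measurable_const.sub (measurable_displacement i))))

lemma hit_mem_Icc {u : ℝ → ℝ} (hu : IsTail u) (x : ℝ) (o : Offspring) :
    hit u x o ∈ Set.Icc (0 : ℝ) 1 := by
  obtain ⟨h0, h1⟩ := prod_one_sub_mem_Icc (Finset.range o.1)
    (f := fun i => u (x - displacement o i)) (fun _ _ => hu.nonneg _) fun _ _ => hu.le_one _
  exact ⟨by unfold hit; linarith, by unfold hit; linarith⟩

lemma integrable_of_abs_le {α : Type*} [MeasurableSpace α] {μ : Measure α} [IsFiniteMeasure μ]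
    {f : α → ℝ} (hf : Measurable f) (C : ℝ) (h : ∀ᵐ x ∂μ, |f x| ≤ C) : Integrable f μ :=
  Integrable.of_bound hf.aestronglyMeasurable C (by simpa using h)

lemma integrable_hit {μ : Measure Offspring} [IsFiniteMeasure μ] {u : ℝ → ℝ} (hu : IsTail u)
    (x : ℝ) : Integrable (hit u x) μ :=
  integrable_of_abs_le (measurable_hit hu x) 1 <| .of_forall fun o => by
    obtain ⟨h0, h1⟩ := hit_mem_Icc hu x o
    rwa [abs_of_nonneg h0]

lemma isTail_step {μ : Measure Offspring} [IsProbabilityMeasure μ] {u : ℝ → ℝ} (hu : IsTail u) :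
    IsTail (step μ u) where
  anti x y hxy := by
    refine integral_mono (integrable_hit hu y) (integrable_hit hu x) fun o => ?_
    exact sub_le_sub_left (Finset.prod_le_prod (fun i _ => by linarith [hu.le_one (x - displacement o i)])
      fun i _ => by linarith [hu.anti (sub_le_sub_right hxy (displacement o i))]) _
  nonneg x := integral_nonneg fun o => (hit_mem_Icc hu x o).1
  le_one x := by
    have := integral_mono (integrable_hit (μ := μ) hu x) (integrable_const (1 : ℝ))
      fun o => (hit_mem_Icc hu x o).2
    simpa [hit, step] using this

/-- The intensity measure of the displacements of the children, of whom there are at most `k₀`. -/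
def intensity (k₀ : ℕ) (μ : Measure Offspring) : Measure ℝ :=
  ∑ i ∈ Finset.range k₀, (μ.restrict {o | i < o.1}).map fun o => displacement o i

lemma measurableSet_lt_numChildren (i : ℕ) : MeasurableSet {o : Offspring | i < o.1} :=
  measurableSet_lt measurable_const measurable_numChildren

instance {k₀ : ℕ} {μ : Measure Offspring} [IsFiniteMeasure μ] : IsFiniteMeasure (intensity k₀ μ) := by
  unfold intensity; infer_instance

lemma intensity_real_univ_le {k₀ : ℕ} {μ : Measure Offspring} [IsProbabilityMeasure μ] :
    (intensity k₀ μ).real Set.univ ≤ k₀ := by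
  have h : intensity k₀ μ Set.univ ≤ (k₀ : ENNReal) := by
    unfold intensity
    rw [Measure.finsetSum_apply]
    calc _ ≤ ∑ i ∈ Finset.range k₀, (1 : ENNReal) := Finset.sum_le_sum fun i _ => by
          rw [Measure.map_apply (measurable_displacement i) .univ]; simpa using prob_le_one
      _ = k₀ := by simp
  have := ENNReal.toReal_mono (by simp) h
  simpa [Measure.real] using this

lemma integral_intensity {k₀ : ℕ} {μ : Measure Offspring} [IsProbabilityMeasure μ]
    (hK : ∀ᵐ o ∂μ, o.1 ≤ k₀) {f : ℝ → ℝ} (hf : Measurable f) {C : ℝ} (hC : ∀ y, |f y| ≤ C) :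
    ∫ y, f y ∂(intensity k₀ μ) = ∫ o, ∑ i ∈ Finset.range o.1, f (displacement o i) ∂μ := by
  have hd : ∀ i, Measurable fun o => f (displacement o i) :=
    fun i => hf.comp (measurable_displacement i)
  unfold intensity
  rw [integral_finsetSum_measure fun i _ => integrable_of_abs_le hf C (.of_forall hC)]
  have e : ∀ i, ∫ y, f y ∂((μ.restrict {o | i < o.1}).map fun o => displacement o i)
      = ∫ o, {o : Offspring | i < o.1}.indicator (fun o => f (displacement o i)) o ∂μ := fun i => by
    rw [integral_map (measurable_displacement i).aemeasurable hf.aestronglyMeasurable,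
      integral_indicator (measurableSet_lt_numChildren i)]
  simp_rw [e]
  rw [← integral_finsetSum _ fun i _ => (integrable_of_abs_le (hd i) C
    (.of_forall fun o => hC _)).indicator (measurableSet_lt_numChildren i)]
  refine integral_congr_ae ?_
  filter_upwards [hK] with o ho
  have : Finset.range o.1 = (Finset.range k₀).filter fun i => i < o.1 := by
    ext i; simp only [Finset.mem_range, Finset.mem_filter]; omega
  rw [this, Finset.sum_filter]
  refine Finset.sum_congr rfl fun i _ => ?_
  simp [Set.indicator_apply]

lemma integrable_sum_displacement {k₀ : ℕ} {μ : Measure Offspring} [IsProbabilityMeasure μ]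
    (hK : ∀ᵐ o ∂μ, o.1 ≤ k₀) {f : ℝ → ℝ} (hf : Measurable f) {C : ℝ} (hC : ∀ y, |f y| ≤ C) :
    Integrable (fun o => ∑ i ∈ Finset.range o.1, f (displacement o i)) μ := by
  have hC0 : 0 ≤ C := (abs_nonneg _).trans (hC 0)
  refine integrable_of_abs_le (measurable_sum_range fun i => hf.comp (measurable_displacement i))
    (k₀ * C) ?_
  filter_upwards [hK] with o ho
  calc _ ≤ ∑ i ∈ Finset.range o.1, |f (displacement o i)| := Finset.abs_sum_le_sum_abs _ _
    _ ≤ ∑ i ∈ Finset.range o.1, C := Finset.sum_le_sum fun i _ => hC _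
    _ = o.1 * C := by simp
    _ ≤ k₀ * C := by gcongr

lemma step_le_integral {k₀ : ℕ} {μ : Measure Offspring} [IsProbabilityMeasure μ]
    (hK : ∀ᵐ o ∂μ, o.1 ≤ k₀) {u : ℝ → ℝ} (hu : IsTail u) (x : ℝ) :
    step μ u x ≤ ∫ y, u (x - y) ∂(intensity k₀ μ) := by
  have hm : Measurable fun y => u (x - y) := hu.measurable.comp (measurable_const.sub measurable_id)
  have hC : ∀ y, |u (x - y)| ≤ 1 := fun y => by
    rw [abs_of_nonneg (hu.nonneg _)]; exact hu.le_one _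
  rw [integral_intensity hK hm hC]
  exact integral_mono (integrable_hit hu x) (integrable_sum_displacement hK hm hC) fun o =>
    one_sub_prod_one_sub_le_sum _ (fun _ _ => hu.nonneg _) fun _ _ => hu.le_one _

/-- Together with `step_le_integral` this encloses the operator between integrals against one
measure on ℝ, so that dependence among siblings no longer matters. -/
lemma integral_damp_le_step {k₀ : ℕ} (hk₀ : 1 ≤ k₀) {μ : Measure Offspring} [IsProbabilityMeasure μ]
    (hK : ∀ᵐ o ∂μ, o.1 ≤ k₀) {u : ℝ → ℝ} (hu : IsTail u) (x : ℝ) :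
    ∫ y, damp k₀ (u (x - y)) ∂(intensity k₀ μ) ≤ step μ u x := by
  have hk : (1 : ℝ) ≤ k₀ := by exact_mod_cast hk₀
  have hd : Monotone (damp (k₀ : ℝ)) := damp_mono (by linarith)
  have hm : Measurable fun y => damp k₀ (u (x - y)) :=
    hd.measurable.comp (hu.measurable.comp (measurable_const.sub measurable_id))
  have hC : ∀ y, |damp k₀ (u (x - y))| ≤ 1 := fun y => by
    have h0 := div_le_damp hk (hu.nonneg (x - y)) (hu.le_one _)
    have h1 : damp k₀ (u (x - y)) ≤ u (x - y) := by
      unfold damp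
      have := min_le_left (u (x - y)) (1 / (k₀ : ℝ))
      nlinarith [sq_nonneg (min (u (x - y)) (1 / (k₀ : ℝ)))]
    have : 0 ≤ u (x - y) / (2 * k₀) := div_nonneg (hu.nonneg _) (by positivity)
    rw [abs_of_nonneg (by linarith)]
    linarith [hu.le_one (x - y)]
  rw [integral_intensity hK hm hC]
  refine integral_mono_ae (integrable_sum_displacement hK hm hC) (integrable_hit hu x) ?_
  filter_upwards [hK] with o ho
  exact sum_damp_le _ hk (by simpa using ho) (fun _ _ => hu.nonneg _) fun _ _ => hu.le_one _

/-! ### One-generation bounds off the event of a large displacement. -/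

/-- The event that some child is displaced by more than `B`. -/
def farSet (B : ℝ) : Set Offspring := {o | ∃ i < o.1, B < |displacement o i|}

lemma measurableSet_farSet (B : ℝ) : MeasurableSet (farSet B) := by
  have : farSet B = ⋃ i : ℕ, {o | i < o.1} ∩ {o | B < |displacement o i|} := by
    ext o; simp [farSet]
  rw [this]
  exact .iUnion fun i => (measurableSet_lt_numChildren i).inter
    (measurableSet_lt measurable_const (measurable_displacement i).abs)

/-- A lower bound for `hit` in terms of one value of the tail. -/
lemma hit_ge {u : ℝ → ℝ} (hu : IsTail u) {B : ℝ} (x : ℝ) {o : Offspring} (ho : o ∉ farSet B) :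
    1 - (1 - u (x + B)) ^ o.1 ≤ hit u x o := by
  refine sub_le_sub_left ?_ _
  rw [← Finset.card_range o.1, ← Finset.prod_const]
  simp only [Finset.card_range]
  refine Finset.prod_le_prod (fun i _ => by linarith [hu.le_one (x - displacement o i)])
    fun i hi => ?_
  have : |displacement o i| ≤ B := by
    by_contra h
    exact ho ⟨i, Finset.mem_range.1 hi, not_le.1 h⟩
  linarith [hu.anti (show x - displacement o i ≤ x + B by linarith [neg_abs_le (displacement o i)])]

lemma integral_indicator_farSet {μ : Measure Offspring} [IsProbabilityMeasure μ] (B b : ℝ) :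
    ∫ o, (farSet B).indicator (fun _ => b) o ∂μ = μ.real (farSet B) * b := by
  rw [integral_indicator (measurableSet_farSet B)]; simp

lemma integrable_indicator_farSet {μ : Measure Offspring} [IsProbabilityMeasure μ] (B b : ℝ) :
    Integrable ((farSet B).indicator fun _ => b) μ :=
  (integrable_const b).indicator (measurableSet_farSet B)

lemma integrable_numChildren {k₀ : ℕ} {μ : Measure Offspring} [IsProbabilityMeasure μ]
    (hK : ∀ᵐ o ∂μ, o.1 ≤ k₀) : Integrable (fun o : Offspring => (o.1 : ℝ)) μ := by
  refine integrable_of_abs_le (measurable_from_nat.comp measurable_numChildren) k₀ ?_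
  filter_upwards [hK] with o ho
  simpa using ho

lemma one_sub_mul_le_step {μ : Measure Offspring} [IsProbabilityMeasure μ]
    (hK : ∀ᵐ o ∂μ, 1 ≤ o.1) {u : ℝ → ℝ} (hu : IsTail u) {B : ℝ} (x : ℝ) :
    (1 - μ.real (farSet B)) * u (x + B) ≤ step μ u x := by
  have h : ∫ o, (u (x + B) - (farSet B).indicator (fun _ => u (x + B)) o) ∂μ ≤ step μ u x := by
    refine integral_mono_ae ((integrable_const _).sub (integrable_indicator_farSet B _))
      (integrable_hit hu x) ?_
    filter_upwards [hK] with o ho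
    change _ ≤ hit u x o
    by_cases hf : o ∈ farSet B
    · simpa [hf] using (hit_mem_Icc hu x o).1
    · have h1 := hit_ge hu x hf
      have h2 : (1 - u (x + B)) ^ o.1 ≤ (1 - u (x + B)) ^ 1 :=
        pow_le_pow_of_le_one (by linarith [hu.le_one (x + B)]) (by linarith [hu.nonneg (x + B)]) ho
      simp only [hf, not_false_eq_true, Set.indicator_of_notMem]
      linarith
  rw [integral_sub (integrable_const _) (integrable_indicator_farSet B _),
    integral_indicator_farSet] at h
  simp only [integral_const, probReal_univ, one_smul] at h
  linarith

/-- With v = u (x + B), K children that stay within B contribute at least Kv - (Kv)²/2; on `farSet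
B` at most k₀ v is forfeited. -/
lemma mean_mul_sub_le_step {k₀ : ℕ} {μ : Measure Offspring} [IsProbabilityMeasure μ]
    (hK : ∀ᵐ o ∂μ, o.1 ≤ k₀) {u : ℝ → ℝ} (hu : IsTail u) {B : ℝ} (x : ℝ) :
    (∫ o, (o.1 : ℝ) ∂μ - k₀ * μ.real (farSet B)) * u (x + B) - k₀ ^ 2 / 2 * u (x + B) ^ 2
      ≤ step μ u x := by
  have hu0 := hu.nonneg (x + B)
  have hu1 := hu.le_one (x + B)
  set v := u (x + B) with hv
  have hi : Integrable (fun o : Offspring => (o.1 : ℝ) * v - k₀ ^ 2 / 2 * v ^ 2) μ :=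
    ((integrable_numChildren hK).mul_const v).sub (integrable_const _)
  have h : ∫ o, ((o.1 * v - k₀ ^ 2 / 2 * v ^ 2) - (farSet B).indicator (fun _ => k₀ * v) o) ∂μ
      ≤ step μ u x := by
    refine integral_mono_ae (hi.sub (integrable_indicator_farSet B _)) (integrable_hit hu x) ?_
    filter_upwards [hK] with o ho
    have ho' : (o.1 : ℝ) ≤ k₀ := by exact_mod_cast ho
    change _ ≤ hit u x o
    by_cases hf : o ∈ farSet B
    · have := (hit_mem_Icc hu x o).1
      simp only [hf, Set.indicator_of_mem]
      nlinarith [mul_nonneg (sub_nonneg.2 ho') hu0, sq_nonneg ((k₀ : ℝ) * v)]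
    · have h1 := hit_ge hu x hf
      have h2 := prod_one_sub_le (Finset.range o.1) (f := fun _ => v) (fun _ _ => hu0)
        fun _ _ => hu1
      simp only [Finset.prod_const, Finset.card_range, Finset.sum_const, nsmul_eq_mul] at h2
      have h3 : ((o.1 : ℝ) * v) ^ 2 ≤ (k₀ * v) ^ 2 := by gcongr
      simp only [hf, not_false_eq_true, Set.indicator_of_notMem]
      rw [mul_pow] at h3
      linarith
  rw [integral_sub hi (integrable_indicator_farSet B _), integral_indicator_farSet,
    integral_sub ((integrable_numChildren hK).mul_const v) (integrable_const _),
    integral_mul_const] at h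
  simp only [integral_const, probReal_univ, one_smul] at h
  linarith

/-- A second child adds v(1 - v), and (K - 1)/k₀ is at most the indicator of K ≥ 2. Averaging turns
the excess of the mean over 1 into logistic growth. -/
lemma branching_le_step {k₀ : ℕ} (hk₀ : 1 ≤ k₀) {μ : Measure Offspring} [IsProbabilityMeasure μ]
    (hK : ∀ᵐ o ∂μ, 1 ≤ o.1 ∧ o.1 ≤ k₀) {u : ℝ → ℝ} (hu : IsTail u) {B : ℝ} (x : ℝ) :
    u (x + B) + (∫ o, (o.1 : ℝ) ∂μ - 1) / k₀ * (u (x + B) * (1 - u (x + B))) - μ.real (farSet B)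
      ≤ step μ u x := by
  have hu0 := hu.nonneg (x + B)
  have hu1 := hu.le_one (x + B)
  have hk : (1 : ℝ) ≤ k₀ := by exact_mod_cast hk₀
  set v := u (x + B) with hv
  have hK' : ∀ᵐ o ∂μ, o.1 ≤ k₀ := hK.mono fun o h => h.2
  have hi0 : Integrable (fun o : Offspring => ((o.1 : ℝ) - 1) / k₀ * (v * (1 - v))) μ :=
    (((integrable_numChildren hK').sub (integrable_const _)).div_const _).mul_const _
  have hi : Integrable (fun o : Offspring => v + ((o.1 : ℝ) - 1) / k₀ * (v * (1 - v))) μ :=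
    (integrable_const _).add hi0
  have h : ∫ o, ((v + ((o.1 : ℝ) - 1) / k₀ * (v * (1 - v))) - (farSet B).indicator (fun _ => 1) o) ∂μ
      ≤ step μ u x := by
    refine integral_mono_ae (hi.sub (integrable_indicator_farSet B _)) (integrable_hit hu x) ?_
    filter_upwards [hK] with o ho
    have ho' : (o.1 : ℝ) ≤ k₀ := by exact_mod_cast ho.2
    have ho1 : (1 : ℝ) ≤ o.1 := by exact_mod_cast ho.1
    have hq1 : ((o.1 : ℝ) - 1) / k₀ ≤ 1 := by rw [div_le_one (by linarith)]; linarith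
    have hvv : 0 ≤ v * (1 - v) := mul_nonneg hu0 (by linarith)
    change _ ≤ hit u x o
    by_cases hf : o ∈ farSet B
    · have := (hit_mem_Icc hu x o).1
      simp only [hf, Set.indicator_of_mem]
      nlinarith
    · have h1 := hit_ge hu x hf
      simp only [hf, not_false_eq_true, Set.indicator_of_notMem]
      rcases ho.1.eq_or_lt with he | hlt
      · rw [← he] at h1 ⊢
        simp only [Nat.cast_one, sub_self, zero_div, zero_mul]
        linarith
      · have h2 : (1 - v) ^ o.1 ≤ (1 - v) ^ 2 :=
          pow_le_pow_of_le_one (by linarith) (by linarith) hlt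
        nlinarith
  rw [integral_sub hi (integrable_indicator_farSet B _), integral_indicator_farSet,
    integral_add (integrable_const _) hi0, integral_mul_const, integral_div,
    integral_sub (integrable_numChildren hK') (integrable_const _)] at h
  simp only [integral_const, probReal_univ, one_smul] at h
  linarith

lemma step_add_le {k₀ : ℕ} {μ : Measure Offspring} [IsProbabilityMeasure μ]
    (hK : ∀ᵐ o ∂μ, o.1 ≤ k₀) {u : ℝ → ℝ} (hu : IsTail u) {B : ℝ} (x : ℝ) :
    step μ u (x + B) ≤ μ.real (farSet B) + k₀ * u x := by
  have h : step μ u (x + B) ≤ ∫ o, ((farSet B).indicator (fun _ => 1) o + k₀ * u x) ∂μ := by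
    refine integral_mono_ae (integrable_hit hu _)
      ((integrable_indicator_farSet B _).add (integrable_const _)) ?_
    filter_upwards [hK] with o ho
    have ho' : (o.1 : ℝ) ≤ k₀ := by exact_mod_cast ho
    have hk : 0 ≤ k₀ * u x := mul_nonneg (by positivity) (hu.nonneg x)
    change hit u (x + B) o ≤ _
    by_cases hf : o ∈ farSet B
    · have := (hit_mem_Icc hu (x + B) o).2
      simp only [hf, Set.indicator_of_mem]
      linarith
    · simp only [hf, not_false_eq_true, Set.indicator_of_notMem, zero_add]
      calc hit u (x + B) o ≤ ∑ i ∈ Finset.range o.1, u (x + B - displacement o i) :=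
            one_sub_prod_one_sub_le_sum _ (fun _ _ => hu.nonneg _) fun _ _ => hu.le_one _
        _ ≤ ∑ i ∈ Finset.range o.1, u x := Finset.sum_le_sum fun i hi => by
            have : |displacement o i| ≤ B := by
              by_contra h
              exact hf ⟨i, Finset.mem_range.1 hi, not_le.1 h⟩
            exact hu.anti (by linarith [le_abs_self (displacement o i)])
        _ = o.1 * u x := by simp
        _ ≤ k₀ * u x := mul_le_mul_of_nonneg_right ho' (hu.nonneg x)
  rw [integral_add (integrable_indicator_farSet B _) (integrable_const _),
    integral_indicator_farSet] at h
  simpa using h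

/-! ### Exponential tails and shifts of monotone functions. -/

/-- Exponential decay of the right tail of a measure. -/
def ExpTail (a M₀ : ℝ) (L : Measure ℝ) : Prop :=
  ∀ M x : ℝ, M₀ < M → 0 ≤ x → L.real (Set.Ioi (x + M)) ≤ Real.exp (-a * M) * L.real (Set.Ioi x)

/-- The hypothesis concerns open half-lines, while A may contain its infimum. Half of the shift h is
spent on an open half-line around A; the other half yields the decay. -/
lemma ExpTail.isUpperSet {a M₀ : ℝ} {L : Measure ℝ} [IsFiniteMeasure L] (hL : ExpTail a M₀ L)
    {h : ℝ} (hh : M₀ < h / 2) (h0 : 0 ≤ h) {A : Set ℝ} (hA : IsUpperSet A) (hAh : ∀ y ∈ A, h ≤ y) :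
    L.real A ≤ Real.exp (-a * (h / 2)) * L.real {y | y + h ∈ A} := by
  rcases A.eq_empty_or_nonempty with rfl | hne
  · simp
  have hbdd : BddBelow A := ⟨h, hAh⟩
  rcases h0.eq_or_lt with rfl | hpos
  · simp
  calc L.real A ≤ L.real (Set.Ioi (sInf A - h + h / 2)) :=
        measureReal_mono fun y hy => by
          have := csInf_le hbdd hy
          simp only [Set.mem_Ioi]; linarith
    _ ≤ Real.exp (-a * (h / 2)) * L.real (Set.Ioi (sInf A - h)) :=
        hL _ _ hh (by linarith [le_csInf hne hAh])
    _ ≤ _ := by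
        refine mul_le_mul_of_nonneg_left (measureReal_mono fun y hy => ?_) (Real.exp_pos _).le
        obtain ⟨z, hz, hzy⟩ := exists_lt_of_csInf_lt hne
          (show sInf A < y + h by linarith [Set.mem_Ioi.1 hy])
        exact hA hzy.le hz

/-- Layer-cake formula: the superlevel sets of f at positive levels are upper sets contained in [h,
∞). -/
lemma ExpTail.integral_le {a M₀ : ℝ} {L : Measure ℝ} [IsFiniteMeasure L] (hL : ExpTail a M₀ L)
    {h : ℝ} (hh : M₀ < h / 2) (h0 : 0 ≤ h) {f : ℝ → ℝ} (hf : Monotone f) (f0 : ∀ y, 0 ≤ f y)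
    {C : ℝ} (f1 : ∀ y, f y ≤ C) (fh : ∀ y ≤ h, f y = 0) :
    ∫ y, f y ∂L ≤ Real.exp (-a * (h / 2)) * ∫ y, f (y + h) ∂L := by
  have hg : Monotone fun y => f (y + h) := fun y z hyz => hf (by linarith)
  have key : ∫⁻ y, ENNReal.ofReal (f y) ∂L
      ≤ ENNReal.ofReal (Real.exp (-a * (h / 2))) * ∫⁻ y, ENNReal.ofReal (f (y + h)) ∂L := by
    rw [lintegral_eq_lintegral_meas_lt L (.of_forall f0) hf.measurable.aemeasurable,
      lintegral_eq_lintegral_meas_lt L (.of_forall fun y => f0 _) hg.measurable.aemeasurable,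
      ← lintegral_const_mul' _ _ ENNReal.ofReal_ne_top]
    refine setLIntegral_mono' measurableSet_Ioi fun t ht => ?_
    have hu := hL.isUpperSet (A := {y | t < f y}) hh h0
      (fun y z hyz (hy : t < f y) => hy.trans_le (hf hyz)) fun y (hy : t < f y) => by
        by_contra hlt
        rw [fh y (not_le.1 hlt).le] at hy
        exact absurd hy (not_lt.2 (le_of_lt ht))
    have := ENNReal.ofReal_le_ofReal hu
    rwa [ENNReal.ofReal_mul (Real.exp_pos _).le, ofReal_measureReal, ofReal_measureReal] at this
  have hfi : Integrable f L := integrable_of_abs_le hf.measurable C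
    (.of_forall fun y => by rw [abs_of_nonneg (f0 y)]; exact f1 y)
  have hgi : Integrable (fun y => f (y + h)) L := integrable_of_abs_le hg.measurable C
    (.of_forall fun y => by rw [abs_of_nonneg (f0 _)]; exact f1 _)
  rw [← ofReal_integral_eq_lintegral_ofReal hfi (.of_forall f0),
    ← ofReal_integral_eq_lintegral_ofReal hgi (.of_forall fun y => f0 _),
    ← ENNReal.ofReal_mul (Real.exp_pos _).le] at key
  exact (ENNReal.ofReal_le_ofReal_iff (mul_nonneg (Real.exp_pos _).le
    (integral_nonneg fun y => f0 _))).1 key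

/-! ### Propagation of the ratio bound through one generation. -/

/-- Where it is small, `u` decays at least by the factor `1 + ε - o(1)` over distances `M`. -/
def RatioBound (ε C M : ℝ) (u : ℝ → ℝ) : Prop :=
  ∀ x, u x * (1 + ε - C * u x) ≤ u (x - M)

/-- Comparison of one value of `damp κ ∘ v` with the values of `v` one half and one full step
earlier: `t = v y`, `t' = v (y + M / 2)`, `t'' = v (y + M)`. -/
lemma le_damp_of_ratio {κ ε C t t' t'' : ℝ} (hκ : 1 ≤ κ) (hC : 0 ≤ C) (hε1 : ε ≤ 1)
    (h0 : 0 ≤ t) (h01 : t ≤ t') (h12 : t' ≤ t'') (h2 : t'' ≤ 1)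
    (hr : t * (1 + ε - C * t) ≤ t'') :
    (1 + ε) * t - (C + 2 * κ) * t ^ 2 + (if 8 * κ * t < t' then t' else 0) / (4 * κ)
      ≤ damp κ t'' := by
  have hκ0 : 0 < κ := by linarith
  split_ifs with h
  -- Steep case: half of t'/(2κ) already dominates 2t, hence (1 + ε)t, and the other half remains as
  -- surplus.
  · have h3 := div_le_damp hκ (by linarith) h2
    have h4 : t' / (2 * κ) ≤ t'' / (2 * κ) := by gcongr
    have h5 : t' / (2 * κ) = t' / (4 * κ) + t' / (4 * κ) := by field_simp; ring
    have h6 : 2 * t ≤ t' / (4 * κ) := by rw [le_div_iff₀ (by positivity)]; linarith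
    nlinarith [mul_nonneg (add_nonneg hC (by linarith : (0 : ℝ) ≤ 2 * κ)) (sq_nonneg t)]
  -- The maximum with t keeps m nonnegative, so that m ≤ 2t also bounds m².
  · set m := max t (t * (1 + ε - C * t)) with hm
    have hm1 : m ≤ t'' := max_le (h01.trans h12) hr
    have hm2 : m ≤ 2 * t := max_le (by linarith) (by nlinarith [mul_nonneg hC (sq_nonneg t)])
    have hm3 : t * (1 + ε - C * t) ≤ m := le_max_right _ _
    have hm0 : 0 ≤ m := h0.trans (le_max_left _ _)
    have h3 := (sub_sq_le_damp hκ0 (t := m)).trans (damp_mono hκ0 hm1)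
    have h4 : m ^ 2 ≤ (2 * t) ^ 2 := by gcongr
    have h5 := mul_le_mul_of_nonneg_left h4 hκ0.le
    rw [zero_div]
    linarith

/-- The pointwise comparison costs a multiple of v² ≤ τv + f, where f = (v² - τ²)⁺ vanishes up to
M/2. The exponential tail bounds the integral of f by a small multiple of that of its shift by M/2.
The shift is either comparable with f + τ², so that its f part is absorbed, or it sits where v
increases steeply, and there the surplus in `le_damp_of_ratio` pays for it. -/
lemma le_integral_damp_of_ratio {a M₀ κ ε C M τ : ℝ} {L : Measure ℝ} [IsFiniteMeasure L]
    (hL : ExpTail a M₀ L) (hLκ : L.real Set.univ ≤ κ) (hκ : 1 ≤ κ) (hC : 0 ≤ C)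
    (hε1 : ε ≤ 1) (hM0 : 0 ≤ M) (hM : M₀ < M / 4)
    (hc : 2 * (C + 2 * κ) * (8 * κ) ^ 2 * κ * Real.exp (-a * (M / 4)) ≤ 1)
    {v : ℝ → ℝ} (hv : Monotone v) (v0 : ∀ y, 0 ≤ v y) (v1 : ∀ y, v y ≤ 1) (hτ0 : 0 ≤ τ)
    (hτ : v (M / 2) ≤ τ) (hr : ∀ y, v y * (1 + ε - C * v y) ≤ v (y + M)) :
    (1 + ε) * ∫ y, v y ∂L - (C + 2 * κ) * (τ * ∫ y, v y ∂L) - τ ^ 2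
      ≤ ∫ y, damp κ (v (y + M)) ∂L := by
  set c := Real.exp (-a * (M / 4)) with hcdef
  have hc0 : 0 < c := Real.exp_pos _
  have hκ0 : 0 < κ := by linarith
  have hshift : ∀ d, Monotone fun y => v (y + d) := fun d y z h => hv (by linarith)
  set f : ℝ → ℝ := fun y => max (v y ^ 2 - τ ^ 2) 0 with hf
  set φ : ℝ → ℝ := fun y => if 8 * κ * v y < v (y + M / 2) then v (y + M / 2) else 0 with hφ
  have hsq : ∀ y, v y ^ 2 ≤ v y := fun y => by nlinarith [v0 y, v1 y]
  have fmono : Monotone f := fun y z h =>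
    max_le_max (sub_le_sub_right (pow_le_pow_left₀ (v0 y) (hv h) 2) _) le_rfl
  have f0 : ∀ y, 0 ≤ f y := fun y => le_max_right _ _
  have f1 : ∀ y, f y ≤ 1 := fun y =>
    max_le (by linarith [sq_nonneg τ, hsq y, v1 y]) zero_le_one
  have fh : ∀ y ≤ M / 2, f y = 0 := fun y hy => max_eq_right <| by
    have := pow_le_pow_left₀ (v0 y) ((hv hy).trans hτ) 2
    linarith
  have φ0 : ∀ y, 0 ≤ φ y := fun y => by simp only [hφ]; split_ifs <;> simp [v0]
  have φ1 : ∀ y, φ y ≤ 1 := fun y => by simp only [hφ]; split_ifs <;> simp [v1]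
  have φmeas : Measurable φ := Measurable.ite
    (measurableSet_lt (hv.measurable.const_mul _) (hshift _).measurable) (hshift _).measurable
    measurable_const
  have dmono : Monotone fun y => damp κ (v (y + M)) := (damp_mono hκ0).comp (hshift M)
  have int01 : ∀ {g : ℝ → ℝ}, Measurable g → (∀ y, 0 ≤ g y) → (∀ y, g y ≤ 1) → Integrable g L :=
    fun hg g0 g1 => integrable_of_abs_le hg 1 (.of_forall fun y => by
      rw [abs_of_nonneg (g0 y)]; exact g1 y)
  have vi : Integrable v L := int01 hv.measurable v0 v1
  have fi : Integrable f L := int01 fmono.measurable f0 f1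
  have fsi : Integrable (fun y => f (y + M / 2)) L :=
    int01 (fmono.measurable.comp (measurable_id.add_const _)) (fun _ => f0 _) fun _ => f1 _
  have φi : Integrable φ L := int01 φmeas φ0 φ1
  have di : Integrable (fun y => damp κ (v (y + M))) L := by
    refine int01 dmono.measurable (fun y => ?_) fun y => ?_
    · exact (div_nonneg (v0 _) (by linarith)).trans (div_le_damp hκ (v0 _) (v1 _))
    · have := min_le_left (v (y + M)) (1 / κ)
      unfold damp
      linarith [v1 (y + M), mul_nonneg (half_pos hκ0).le (sq_nonneg (min (v (y + M)) (1 / κ)))]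
  -- the exponential tail controls the excess of `v` over `τ` by the rapid increase of `v`
  have hfs : ∀ y, f (y + M / 2) ≤ φ y + (8 * κ) ^ 2 * f y + (8 * κ) ^ 2 * τ ^ 2 := fun y => by
    have hK : 1 ≤ (8 * κ) ^ 2 := by nlinarith
    have hfy := f0 y
    have hφy := φ0 y
    refine max_le ?_ (by positivity)
    by_cases h : 8 * κ * v y < v (y + M / 2)
    · have : φ y = v (y + M / 2) := if_pos h
      rw [this]
      have := hsq (y + M / 2)
      have : 0 ≤ (8 * κ) ^ 2 * f y := by positivity
      nlinarith [sq_nonneg τ]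
    · have h1 := pow_le_pow_left₀ (v0 _) (not_lt.1 h) 2
      have h2 : v y ^ 2 - τ ^ 2 ≤ f y := le_max_left _ _
      rw [mul_pow] at h1
      nlinarith [sq_nonneg τ]
  have hf_le : ∫ y, f y ∂L ≤ c * (∫ y, φ y ∂L + (8 * κ) ^ 2 * ∫ y, f y ∂L
      + (8 * κ) ^ 2 * τ ^ 2 * κ) := by
    have h1 := hL.integral_le (h := M / 2) (by linarith) (by linarith) fmono f0 f1 fh
    rw [show M / 2 / 2 = M / 4 by ring, ← hcdef] at h1
    refine h1.trans (mul_le_mul_of_nonneg_left ?_ hc0.le)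
    have i1 : Integrable (fun y => φ y + (8 * κ) ^ 2 * f y) L := φi.add (fi.const_mul _)
    have i2 : Integrable (fun y => φ y + (8 * κ) ^ 2 * f y + (8 * κ) ^ 2 * τ ^ 2) L :=
      i1.add (integrable_const _)
    have h2 := integral_mono fsi i2 hfs
    rw [integral_add i1 (integrable_const _), integral_add φi (fi.const_mul _),
      integral_const_mul, integral_const, smul_eq_mul] at h2
    have h3 : L.real Set.univ * ((8 * κ) ^ 2 * τ ^ 2) ≤ κ * ((8 * κ) ^ 2 * τ ^ 2) :=
      mul_le_mul_of_nonneg_right hLκ (by positivity)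
    linarith
  -- integrate the pointwise comparison
  have hpt : ∀ y, (1 + ε) * v y - (C + 2 * κ) * (τ * v y + f y) + φ y / (4 * κ)
      ≤ damp κ (v (y + M)) := fun y => by
    have h1 := le_damp_of_ratio hκ hC hε1 (v0 y) (hv (by linarith : y ≤ y + M / 2))
      (hv (by linarith : y + M / 2 ≤ y + M)) (v1 _) (hr y)
    have h2 : v y ^ 2 ≤ τ * v y + f y := by
      rcases le_total (v y) τ with h | h
      · nlinarith [f0 y, v0 y]
      · have : v y ^ 2 - τ ^ 2 ≤ f y := le_max_left _ _
        nlinarith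
    have h3 := mul_le_mul_of_nonneg_left h2 (by linarith : 0 ≤ C + 2 * κ)
    simp only [hφ]
    linarith
  have i1 : Integrable (fun y => τ * v y + f y) L := (vi.const_mul τ).add fi
  have i2 : Integrable (fun y => (1 + ε) * v y - (C + 2 * κ) * (τ * v y + f y)) L :=
    (vi.const_mul (1 + ε)).sub (i1.const_mul (C + 2 * κ))
  have i3 : Integrable (fun y => (1 + ε) * v y - (C + 2 * κ) * (τ * v y + f y) + φ y / (4 * κ)) L :=
    i2.add (φi.div_const (4 * κ))
  have hint := integral_mono i3 di hpt
  rw [integral_add i2 (φi.div_const (4 * κ)),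
    integral_sub (vi.const_mul (1 + ε)) (i1.const_mul (C + 2 * κ)),
    integral_const_mul, integral_const_mul, integral_add (vi.const_mul τ) fi, integral_const_mul,
    integral_div] at hint
  have hΦ0 : 0 ≤ ∫ y, φ y ∂L := integral_nonneg φ0
  have hF0 : 0 ≤ ∫ y, f y ∂L := integral_nonneg f0
  generalize ∫ y, φ y ∂L = Φ at *
  generalize ∫ y, f y ∂L = F at *
  generalize ∫ y, v y ∂L = V at *
  have hD : 1 ≤ C + 2 * κ := by linarith
  generalize C + 2 * κ = D at *
  have hDF : D * F ≤ Φ / (4 * κ) + τ ^ 2 := by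
    -- The coefficient of F on the right of `hf_le` is thus at most 1/2, and F is absorbed at the
    -- price of a factor 2.
    have e1 : (8 * κ) ^ 2 * c ≤ 1 / 2 := by
      have : 1 ≤ D * κ := by nlinarith
      nlinarith [mul_pos (pow_pos (by positivity : 0 < 8 * κ) 2) hc0]
    have e2 : F ≤ 2 * c * Φ + 2 * c * (8 * κ) ^ 2 * τ ^ 2 * κ := by nlinarith
    have e3 : D * (2 * c * (8 * κ) ^ 2 * τ ^ 2 * κ) ≤ τ ^ 2 := by
      nlinarith [mul_le_mul_of_nonneg_right hc (sq_nonneg τ)]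
    have e4 : D * (2 * c * Φ) ≤ Φ / (4 * κ) := by
      rw [le_div_iff₀ (by positivity)]
      have : 2 * D * c * (4 * κ) ≤ 1 := by
        refine le_trans ?_ hc
        have : 4 * κ ≤ (8 * κ) ^ 2 * κ := by nlinarith
        have := mul_le_mul_of_nonneg_left this (by positivity : 0 ≤ 2 * D * c)
        linarith
      nlinarith [mul_le_mul_of_nonneg_right this hΦ0]
    nlinarith [mul_le_mul_of_nonneg_left e2 (by linarith : 0 ≤ D)]
  linarith

/-- Little growth of the new tail forces a small old one. A single child gives v ≤ 4ω for v = u (z +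
B); this bounds the quadratic loss by (s/4)v, and a net growth factor 1 + 5s/8 remains. -/
lemma le_of_step_sub_le {k₀ : ℕ} {μ : Measure Offspring} [IsProbabilityMeasure μ]
    (hk₀ : 1 ≤ k₀) (hK : ∀ᵐ o ∂μ, 1 ≤ o.1 ∧ o.1 ≤ k₀) {s : ℝ} (hs0 : 0 < s) (hs1 : s ≤ 1)
    (hmean : 1 + s ≤ ∫ o, (o.1 : ℝ) ∂μ) {B : ℝ} (hB : k₀ * μ.real (farSet B) ≤ s / 8)
    {C : ℝ} (hC : (k₀ : ℝ) ^ 2 ≤ C) {u : ℝ → ℝ} (hu : IsTail u) {z ω : ℝ}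
    (hω0 : 0 ≤ ω) (hω : C * ω ≤ s / 8) (hz : step μ u z ≤ (1 + s / 8) * ω) :
    u (z + B) ≤ (1 - s / 8) * ω := by
  have hk : (1 : ℝ) ≤ k₀ := by exact_mod_cast hk₀
  have hη0 : 0 ≤ μ.real (farSet B) := measureReal_nonneg
  have h1 := (one_sub_mul_le_step (B := B) (hK.mono fun o h => h.1) hu z).trans hz
  have h2 := (mean_mul_sub_le_step (B := B) (hK.mono fun o h => h.2) hu z).trans hz
  have hu0 := hu.nonneg (z + B)
  generalize u (z + B) = v at *
  generalize μ.real (farSet B) = η at *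
  have hη : η ≤ s / 8 := le_trans (by nlinarith) hB
  have h4 : v ≤ 4 * ω := by nlinarith
  have h5 : (k₀ : ℝ) ^ 2 * ω ≤ s / 8 := (mul_le_mul_of_nonneg_right hC hω0).trans hω
  have h6 : (k₀ : ℝ) ^ 2 / 2 * v ^ 2 ≤ s / 4 * v := by
    have : (k₀ : ℝ) ^ 2 * v ≤ s / 2 := by
      nlinarith [mul_le_mul_of_nonneg_left h4 (sq_nonneg (k₀ : ℝ))]
    nlinarith
  have h7 : (1 + s - s / 8) * v ≤ (∫ o, (o.1 : ℝ) ∂μ - k₀ * η) * v :=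
    mul_le_mul_of_nonneg_right (by linarith) hu0
  have h8 : (1 + 5 * s / 8) * v ≤ (1 + s / 8) * ω := by nlinarith
  have h9 : 1 + s / 8 ≤ (1 + 5 * s / 8) * (1 - s / 8) := by nlinarith
  have h10 : (1 + 5 * s / 8) * v ≤ (1 + 5 * s / 8) * ((1 - s / 8) * ω) := by
    nlinarith [mul_le_mul_of_nonneg_right h9 hω0]
  exact le_of_mul_le_mul_left h10 (by linarith)

/-- The invariant closes because `hC1` gives (C + 2k)(1 - s/8) + 1 ≤ C: the contraction pays for
both new quadratic terms. The coefficient of V is nonnegative, so V may be lowered to ω. -/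
lemma ratio_le_of_le {k s C ω V : ℝ} (hk : 0 ≤ k) (hs0 : 0 < s) (hs1 : s ≤ 1)
    (hC1 : 2 * k + 1 ≤ C * (s / 8)) (hω0 : 0 ≤ ω) (hω : C * ω < s / 8) (hV : ω ≤ V) :
    ω * (1 + s / 8 - C * ω)
      ≤ (1 + s / 8) * V - (C + 2 * k) * ((1 - s / 8) * ω * V) - ((1 - s / 8) * ω) ^ 2 := by
  have hC : 2 * k + 1 ≤ C := by nlinarith
  have hq0 : 0 ≤ 1 - s / 8 := by linarith
  have hkω : 2 * k * ω ≤ s / 8 :=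
    (mul_le_mul_of_nonneg_right (by linarith) hω0).trans hω.le
  have hqω : (1 - s / 8) * ω ≤ ω := mul_le_of_le_one_left hω0 (by linarith)
  have h1 : (C + 2 * k) * ((1 - s / 8) * ω) ≤ (C + 2 * k) * ω :=
    mul_le_mul_of_nonneg_left hqω (by linarith)
  have hp : 0 ≤ 1 + s / 8 - (C + 2 * k) * ((1 - s / 8) * ω) := by linarith
  have h5 := mul_le_mul_of_nonneg_left hV hp
  have h6 : ((1 - s / 8) * ω) ^ 2 ≤ ω ^ 2 := pow_le_pow_left₀ (mul_nonneg hq0 hω0) hqω 2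
  have h7 : (C + 2 * k) * (1 - s / 8) + 1 ≤ C := by nlinarith
  have h8 := mul_le_mul_of_nonneg_right h7 (sq_nonneg ω)
  linarith

theorem RatioBound.step {k₀ : ℕ} {μ : Measure Offspring} [IsProbabilityMeasure μ]
    (hk₀ : 1 ≤ k₀) (hK : ∀ᵐ o ∂μ, 1 ≤ o.1 ∧ o.1 ≤ k₀) {s : ℝ} (hs0 : 0 < s) (hs1 : s ≤ 1)
    (hmean : 1 + s ≤ ∫ o, (o.1 : ℝ) ∂μ) {B : ℝ} (hB : k₀ * μ.real (farSet B) ≤ s / 8)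
    {a M₀ : ℝ} (hL : ExpTail a M₀ (intensity k₀ μ)) {C M : ℝ} (hC1 : 2 * k₀ + 1 ≤ C * (s / 8))
    (hC2 : (k₀ : ℝ) ^ 2 ≤ C) (hM0 : 0 ≤ M) (hMB : B ≤ M / 2) (hM : M₀ < M / 4)
    (hc : 2 * (C + 2 * k₀) * (8 * k₀) ^ 2 * k₀ * Real.exp (-a * (M / 4)) ≤ 1)
    {u : ℝ → ℝ} (hu : IsTail u) (hr : RatioBound (s / 8) C M u) :
    RatioBound (s / 8) C M (step μ u) := by
  intro x
  have hk : (1 : ℝ) ≤ k₀ := by exact_mod_cast hk₀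
  have hw := isTail_step (μ := μ) hu
  have hω0 := hw.nonneg x
  have hanti := hw.anti (show x - M ≤ x by linarith)
  have hC0 : 0 ≤ C := le_trans (by positivity) hC2
  set ω := GBRW.step μ u x with hω
  rcases le_or_gt (s / 8) (C * ω) with hbig | hsmall
  · nlinarith
  rcases le_or_gt ((1 + s / 8) * ω) (GBRW.step μ u (x - M)) with hgood | hbad
  · nlinarith [mul_nonneg hC0 (sq_nonneg ω)]
  -- Applied at z = x - M; since B ≤ M/2, the contraction holds at x - M/2 too.
  have hθ := le_of_step_sub_le hk₀ hK hs0 hs1 hmean hB hC2 hu hω0 hsmall.le hbad.le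
  have hv : Monotone fun y => u (x - y) := fun y z h => hu.anti (by linarith)
  have hτ : u (x - M / 2) ≤ (1 - s / 8) * ω := (hu.anti (by linarith)).trans hθ
  have h1 := le_integral_damp_of_ratio (ε := s / 8) hL intensity_real_univ_le hk hC0 (by linarith)
    hM0 hM hc hv (fun y => hu.nonneg _) (fun y => hu.le_one _)
    (mul_nonneg (by linarith) hω0) hτ fun y => by
      have := hr (x - y)
      rwa [sub_sub] at this
  have h2 := step_le_integral (hK.mono fun o h => h.2) hu x
  have h3 := integral_damp_le_step hk₀ (hK.mono fun o h => h.2) hu (x - M)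
  have e : ∀ y, x - M - y = x - (y + M) := fun y => by ring
  simp_rw [e] at h3
  rw [← hω] at h2
  generalize ∫ y, u (x - y) ∂(intensity k₀ μ) = V at *
  have h4 := h1.trans h3
  refine le_trans ?_ h4
  exact ratio_le_of_le (by positivity) hs0 hs1 hC1 hω0 hsmall h2

/-! ### Iteration over generations. -/

/-- The tail of the maximal displacement after `n` generations of a walk started at time `m`, the
offspring law at time `j` being `μ j`. -/
def maxTail (μ : ℕ → Measure Offspring) : ℕ → ℕ → ℝ → ℝ
  | 0, _ => fun x => if x < 0 then 1 else 0
  | n + 1, m => step (μ m) (maxTail μ n (m + 1))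

lemma isTail_maxTail {μ : ℕ → Measure Offspring} [∀ n, IsProbabilityMeasure (μ n)] (n m : ℕ) :
    IsTail (maxTail μ n m) := by
  induction n generalizing m with
  | zero =>
    refine ⟨fun x y h => ?_, fun x => ?_, fun x => ?_⟩
    · simp only [maxTail]
      split_ifs <;> linarith
    · simp only [maxTail]; split_ifs <;> norm_num
    · simp only [maxTail]; split_ifs <;> norm_num
  | succ n ih => exact isTail_step (ih (m + 1))

/-- The assumptions on the offspring laws that give tightness, uniformly in time. -/
structure UniformOffspring (k₀ : ℕ) (s a M₀ : ℝ) (μ : ℕ → Measure Offspring) : Prop where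
  prob : ∀ n, IsProbabilityMeasure (μ n)
  bound : ∀ n, ∀ᵐ o ∂(μ n), 1 ≤ o.1 ∧ o.1 ≤ k₀
  mean : ∀ n, 1 + s ≤ ∫ o, (o.1 : ℝ) ∂(μ n)
  far : ∀ η : ℝ, 0 < η → ∃ B : ℝ, ∀ n, (μ n).real (farSet B) ≤ η
  tail : ∀ n, ExpTail a M₀ (intensity k₀ (μ n))

namespace UniformOffspring

variable {k₀ : ℕ} {s a M₀ : ℝ} {μ : ℕ → Measure Offspring}

lemma exists_ratioBound (h : UniformOffspring k₀ s a M₀ μ) (hk₀ : 1 ≤ k₀) (hs0 : 0 < s)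
    (hs1 : s ≤ 1) (ha : 0 < a) :
    ∃ ε C M : ℝ, 0 < ε ∧ 0 < C ∧ 0 < M ∧ ∀ n m, RatioBound ε C M (maxTail μ n m) := by
  have hk : (1 : ℝ) ≤ k₀ := by exact_mod_cast hk₀
  have := h.prob
  obtain ⟨B, hB⟩ := h.far (s / 8 / k₀) (by positivity)
  set C : ℝ := (2 * k₀ + 1) * (8 / s) + (k₀ : ℝ) ^ 2 with hC
  have hC0 : 0 < C := by positivity
  have hC2 : (k₀ : ℝ) ^ 2 ≤ C := by
    have : 0 < (2 * k₀ + 1) * (8 / s) := by positivity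
    linarith
  have hC1 : 2 * k₀ + 1 ≤ C * (s / 8) := by
    have : C * (s / 8) = 2 * k₀ + 1 + (k₀ : ℝ) ^ 2 * (s / 8) := by rw [hC]; field_simp
    rw [this]
    have : 0 < (k₀ : ℝ) ^ 2 * (s / 8) := by positivity
    linarith
  set D : ℝ := 2 * (C + 2 * k₀) * (8 * k₀) ^ 2 * k₀ with hD
  have hD0 : 0 < D := by positivity
  -- In order: B ≤ M/2, M₀ < M/4, smallness of the exponential factor, and positivity.
  set M : ℝ := max (max (2 * B) (4 * M₀ + 1)) (max (4 / a * Real.log D) 1) with hM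
  have hMB : 2 * B ≤ M := (le_max_left _ _).trans (le_max_left _ _)
  have hMM : 4 * M₀ + 1 ≤ M := (le_max_right _ _).trans (le_max_left _ _)
  have hMD : 4 / a * Real.log D ≤ M := (le_max_left _ _).trans (le_max_right _ _)
  have hM1 : 1 ≤ M := (le_max_right _ _).trans (le_max_right _ _)
  have hc : D * Real.exp (-a * (M / 4)) ≤ 1 := by
    have h1 : Real.log D ≤ a * (M / 4) := by
      have := mul_le_mul_of_nonneg_left hMD (by positivity : 0 ≤ a / 4)
      have e : a / 4 * (4 / a * Real.log D) = Real.log D := by field_simp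
      linarith
    calc D * Real.exp (-a * (M / 4)) = Real.exp (Real.log D + -a * (M / 4)) := by
          rw [Real.exp_add, Real.exp_log hD0]
      _ ≤ 1 := Real.exp_le_one_iff.2 (by linarith)
  refine ⟨s / 8, C, M, by positivity, hC0, by linarith, fun n => ?_⟩
  induction n with
  | zero =>
    intro m x
    have hCs : s / 8 ≤ C := by
      have : 1 ≤ (k₀ : ℝ) ^ 2 := one_le_pow₀ hk
      linarith
    simp only [maxTail]
    by_cases hx : x < 0
    · rw [if_pos hx, if_pos (by linarith)]; linarith
    · rw [if_neg hx]; split_ifs <;> simp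
  | succ n ih =>
    intro m
    refine RatioBound.step hk₀ (h.bound m) hs0 hs1 (h.mean m) (B := B) ?_ (h.tail m) hC1 hC2
      (by linarith) (by linarith) (by linarith) hc (isTail_maxTail n (m + 1)) (ih (m + 1))
    have := mul_le_mul_of_nonneg_left (hB m) (by linarith : (0 : ℝ) ≤ k₀)
    rwa [mul_div_cancel₀ _ (by positivity)] at this

lemma exists_maxTail_le (h : UniformOffspring k₀ s a M₀ μ) (hk₀ : 1 ≤ k₀) (n m : ℕ) {η : ℝ}
    (hη : 0 < η) : ∃ x, maxTail μ n m x ≤ η := by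
  have hk : (1 : ℝ) ≤ k₀ := by exact_mod_cast hk₀
  have := h.prob
  induction n generalizing m η with
  | zero => exact ⟨0, by simpa [maxTail] using hη.le⟩
  | succ n ih =>
    obtain ⟨x, hx⟩ := ih (m + 1) (η := η / 2 / k₀) (by positivity)
    obtain ⟨B, hB⟩ := h.far (η / 2) (by positivity)
    refine ⟨x + B, (step_add_le ((h.bound m).mono fun o h => h.2) (isTail_maxTail n (m + 1))
      x).trans ?_⟩
    have := mul_le_mul_of_nonneg_left hx (by linarith : (0 : ℝ) ≤ k₀)
    rw [mul_div_cancel₀ _ (by positivity)] at this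
    linarith [hB m]

lemma exists_le_maxTail (h : UniformOffspring k₀ s a M₀ μ) (n m : ℕ) {η : ℝ}
    (hη : 0 < η) : ∃ x, 1 - η ≤ maxTail μ n m x := by
  have := h.prob
  induction n generalizing m η with
  | zero => exact ⟨-1, by simpa [maxTail] using hη.le⟩
  | succ n ih =>
    obtain ⟨x, hx⟩ := ih (m + 1) (η := η / 2) (by positivity)
    obtain ⟨B, hB⟩ := h.far (η / 2) (by positivity)
    have hu := isTail_maxTail (μ := μ) n (m + 1)
    refine ⟨x - B, le_trans ?_ (one_sub_mul_le_step (B := B) ((h.bound m).mono fun o h => h.1) hu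
      (x - B))⟩
    rw [sub_add_cancel]
    have h1 := hu.le_one x
    have h2 : 0 ≤ (μ m).real (farSet B) := measureReal_nonneg
    nlinarith [hB m]

lemma maxTail_add_le (h : UniformOffspring k₀ s a M₀ μ) (hk₀ : 1 ≤ k₀) {B η : ℝ} (hη : 0 ≤ η)
    (hB : ∀ n, (μ n).real (farSet B) ≤ η) (r J m : ℕ) (x : ℝ) :
    maxTail μ (r + J) m (x + J * B) ≤ (k₀ : ℝ) ^ J * (maxTail μ r (m + J) x + J * η) := by
  have hk : (1 : ℝ) ≤ k₀ := by exact_mod_cast hk₀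
  have := h.prob
  induction J generalizing m with
  | zero => simp
  | succ J ih =>
    have h1 := ih (m + 1)
    rw [show m + 1 + J = m + (J + 1) by ring] at h1
    have h2 := step_add_le ((h.bound m).mono fun o h => h.2) (B := B)
      (isTail_maxTail (μ := μ) (r + J) (m + 1)) (x + J * B)
    have h3 := mul_le_mul_of_nonneg_left h1 (by linarith : (0 : ℝ) ≤ k₀)
    have h4 : η ≤ (k₀ : ℝ) ^ (J + 1) * η := le_mul_of_one_le_left hη (one_le_pow₀ hk)
    rw [← add_assoc, show x + ((J + 1 : ℕ) : ℝ) * B = x + J * B + B by push_cast; ring]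
    refine h2.trans ?_
    push_cast
    rw [pow_succ] at h4 ⊢
    linarith [hB m]

/-- As long as v ≥ δ, the logistic gain is at least γδ(1 - v) with γ = s/k₀. The gap 1 - v therefore
contracts by 1 - γδ per generation, up to an error γδε/2 whose fixed point is ε/2. The condition δ +
ε/2 ≤ 1 keeps the tail above δ. -/
lemma le_maxTail_sub (h : UniformOffspring k₀ s a M₀ μ) (hk₀ : 1 ≤ k₀) (hs0 : 0 < s)
    {δ ε B : ℝ} (hδ : 0 < δ) (hδε : δ + ε / 2 ≤ 1) (hε : 0 ≤ ε) (hδs : s / k₀ * δ ≤ 1)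
    (hB : ∀ n, (μ n).real (farSet B) ≤ s / k₀ * δ * (ε / 2)) (r J m : ℕ) {x : ℝ}
    (hx : δ ≤ maxTail μ r (m + J) x) :
    δ ≤ maxTail μ (r + J) m (x - J * B) ∧
      1 - ((1 - s / k₀ * δ) ^ J + ε / 2) ≤ maxTail μ (r + J) m (x - J * B) := by
  have hk : (1 : ℝ) ≤ k₀ := by exact_mod_cast hk₀
  have := h.prob
  induction J generalizing m with
  | zero =>
    have := (isTail_maxTail (μ := μ) r m).nonneg x
    simp only [add_zero] at hx
    exact ⟨by simpa using hx, by simp; linarith⟩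
  | succ J ih =>
    have hu := isTail_maxTail (μ := μ) (r + J) (m + 1)
    obtain ⟨h1, h2⟩ := ih (m + 1) (by rwa [show m + 1 + J = m + (J + 1) by ring])
    have h3 := branching_le_step hk₀ (h.bound m) hu (B := B) (x - (J + 1 : ℕ) * B)
    rw [show x - ((J + 1 : ℕ) : ℝ) * B + B = x - J * B by push_cast; ring] at h3
    rw [← add_assoc]
    change δ ≤ GBRW.step (μ m) _ _ ∧ _ ≤ GBRW.step (μ m) _ _
    have hv1 := hu.le_one (x - J * B)
    generalize maxTail μ (r + J) (m + 1) (x - J * B) = v at *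
    generalize GBRW.step (μ m) _ _ = w at *
    have hγ : s / k₀ ≤ (∫ o, (o.1 : ℝ) ∂(μ m) - 1) / k₀ := by
      gcongr; linarith [h.mean m]
    have hγ0 : 0 < s / k₀ := by positivity
    have h4 := mul_le_mul_of_nonneg_right hγ
      (mul_nonneg (hδ.le.trans h1) (by linarith : 0 ≤ 1 - v))
    have hBm := hB m
    generalize s / (k₀ : ℝ) = γ at *
    have h5 : γ * (δ * (1 - v)) ≤ γ * (v * (1 - v)) :=
      mul_le_mul_of_nonneg_left (mul_le_mul_of_nonneg_right h1 (by linarith)) hγ0.le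
    have h6 : 1 - w ≤ (1 - v) * (1 - γ * δ) + γ * δ * (ε / 2) := by linarith
    have hρ : 0 ≤ 1 - γ * δ := by linarith
    have hγδ : 0 ≤ γ * δ := by positivity
    constructor
    · have := mul_le_mul_of_nonneg_right (by linarith : 1 - v ≤ 1 - δ) hρ
      have := mul_le_mul_of_nonneg_left (by linarith : ε / 2 ≤ 1 - δ) hγδ
      linarith
    · have := mul_le_mul_of_nonneg_right (by linarith : 1 - v ≤ (1 - γ * δ) ^ J + ε / 2) hρ
      rw [pow_succ]
      linarith

end UniformOffspring

/-- To the right of z the correction C u is at most ε/2, so every step of length M gains a factor 1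
+ ε/2. -/
lemma RatioBound.le_pow {ε C M : ℝ} (hε : 0 < ε) (hC : 0 < C) (hM : 0 < M) {u : ℝ → ℝ}
    (hu : IsTail u) (hr : RatioBound ε C M u) {z : ℝ} (hz : u z ≤ ε / (2 * C)) (l : ℕ) :
    u (z + l * M) ≤ ((1 + ε / 2)⁻¹) ^ l := by
  induction l with
  | zero => simpa using hu.le_one z
  | succ l ih =>
    have h1 := hr (z + (l + 1 : ℕ) * M)
    rw [show z + ((l + 1 : ℕ) : ℝ) * M - M = z + l * M by push_cast; ring] at h1
    have h2 : u (z + (l + 1 : ℕ) * M) ≤ ε / (2 * C) :=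
      (hu.anti (le_add_of_nonneg_right (by positivity))).trans hz
    have h0 := hu.nonneg (z + (l + 1 : ℕ) * M)
    generalize u (z + (l + 1 : ℕ) * M) = t at *
    have h3 : C * t ≤ ε / 2 := by
      have := mul_le_mul_of_nonneg_left h2 hC.le
      have e : C * (ε / (2 * C)) = ε / 2 := by field_simp
      linarith
    have h4 : t * (1 + ε / 2) ≤ ((1 + ε / 2)⁻¹) ^ l := by nlinarith
    rw [pow_succ, ← div_eq_mul_inv, le_div_iff₀ (by positivity)]
    exact h4

/-- From some generation on, the tail of the maximum falls from near `1` to near `0` within a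
bounded distance. -/
theorem UniformOffspring.exists_window {k₀ : ℕ} {s a M₀ : ℝ} {μ : ℕ → Measure Offspring}
    (h : UniformOffspring k₀ s a M₀ μ) (hk₀ : 1 ≤ k₀) (hs0 : 0 < s) (hs1 : s ≤ 1) (ha : 0 < a)
    {ε : ℝ} (hε0 : 0 < ε) (hε1 : ε ≤ 1) :
    ∃ (J : ℕ) (A : ℝ), ∀ r m, ∃ z, maxTail μ (r + J) m (z + A) ≤ ε ∧
      1 - ε ≤ maxTail μ (r + J) m (z - A) := by
  have hk : (1 : ℝ) ≤ k₀ := by exact_mod_cast hk₀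
  have := h.prob
  obtain ⟨e, C, M, he, hC, hM, hr⟩ := h.exists_ratioBound hk₀ hs0 hs1 ha
  obtain ⟨δ, hδ0, hδ1, hδ2⟩ : ∃ δ : ℝ, 0 < δ ∧ δ ≤ e / (2 * C) ∧ δ ≤ 1 / 2 :=
    ⟨min (e / (2 * C)) (1 / 2), lt_min (by positivity) (by norm_num), min_le_left _ _,
      min_le_right _ _⟩
  have hγ0 : 0 < s / k₀ := by positivity
  have hγ1 : s / k₀ ≤ 1 := by rw [div_le_one (by linarith)]; linarith
  have hγδ : s / k₀ * δ ≤ 1 := by nlinarith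
  obtain ⟨J, hJ⟩ := exists_pow_lt_of_lt_one (half_pos hε0)
    (show 1 - s / k₀ * δ < 1 by linarith [mul_pos hγ0 hδ0])
  obtain ⟨B₁, hB₁⟩ := h.far (s / k₀ * δ * (ε / 2)) (by positivity)
  have hkJ : 0 < (k₀ : ℝ) ^ J := by positivity
  -- J is fixed by the left side alone, so l and B₂ may be chosen afterwards to beat k₀^J.
  obtain ⟨l, hl⟩ := exists_pow_lt_of_lt_one (show 0 < ε / 2 / (k₀ : ℝ) ^ J by positivity)
    (show (1 + e / 2)⁻¹ < 1 from inv_lt_one_of_one_lt₀ (by linarith))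
  obtain ⟨B₂, hB₂⟩ := h.far (ε / 2 / (k₀ : ℝ) ^ J / (J + 1)) (by positivity)
  refine ⟨J, max (l * M + J * B₂) (1 + J * B₁), fun r m => ?_⟩
  have hu := isTail_maxTail (μ := μ) r (m + J)
  have hw := isTail_maxTail (μ := μ) (r + J) m
  -- The tail may jump across δ; the unit of slack replaces continuity.
  obtain ⟨z, hz, hz1⟩ : ∃ z, maxTail μ r (m + J) z ≤ δ ∧ δ ≤ maxTail μ r (m + J) (z - 1) := by
    have hne : {x | maxTail μ r (m + J) x ≤ δ}.Nonempty := h.exists_maxTail_le hk₀ r (m + J) hδ0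
    obtain ⟨b, hb⟩ := h.exists_le_maxTail r (m + J) (show 0 < (1 - δ) / 2 by linarith)
    have hbd : BddBelow {x | maxTail μ r (m + J) x ≤ δ} := ⟨b, fun x hx => by
      by_contra hlt
      have := hu.anti (not_le.1 hlt).le
      have hx' : maxTail μ r (m + J) x ≤ δ := hx
      linarith⟩
    obtain ⟨z, hz, hlt⟩ := exists_lt_of_csInf_lt hne (lt_add_one (sInf {x | maxTail μ r (m + J) x ≤ δ}))
    refine ⟨z, hz, ?_⟩
    by_contra hcon
    have := csInf_le hbd (show z - 1 ∈ {x | maxTail μ r (m + J) x ≤ δ} from (not_le.1 hcon).le)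
    linarith
  refine ⟨z, ?_, ?_⟩
  · refine (hw.anti (show z + l * M + J * B₂ ≤ _ by
      linarith [le_max_left (l * M + J * B₂) (1 + J * B₁)])).trans ?_
    have h1 := h.maxTail_add_le hk₀ (by positivity) hB₂ r J m (z + l * M)
    have h2 := (hr r (m + J)).le_pow he hC hM hu (hz.trans hδ1) l
    refine h1.trans ?_
    have h3 : (J : ℝ) * (ε / 2 / (k₀ : ℝ) ^ J / (J + 1)) ≤ ε / 2 / (k₀ : ℝ) ^ J := by
      rw [mul_div_assoc', div_le_iff₀ (by positivity), mul_comm]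
      exact mul_le_mul_of_nonneg_left (by linarith) (by positivity)
    have h4 := mul_le_mul_of_nonneg_left (add_le_add (h2.trans hl.le) h3) hkJ.le
    refine h4.trans (le_of_eq ?_)
    field_simp
    norm_num
  · have h1 := (h.le_maxTail_sub hk₀ hs0 hδ0 (by linarith) hε0.le hγδ hB₁ r J m hz1).2
    have h2 := hw.anti (show z - max (l * M + J * B₂) (1 + J * B₁) ≤ z - 1 - J * B₁ by
      linarith [le_max_right (l * M + J * B₂) (1 + J * B₁)])
    linarith

/-! ### Decomposition at the root and the law of the maximum. -/

lemma location_append_singleton (c : List ℕ → Offspring) (i : ℕ) (w : List ℕ) :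
    location c (w ++ [i]) = displacement (c []) i + location (fun v => c (v ++ [i])) w := by
  induction w with
  | nil => simp [location]
  | cons j w ih => simp only [List.cons_append, location, ih]; ring

/-- Labels grow at the head, so the descendants of the root's i-th child are the words ending in i.
-/
lemma isBorn_append_singleton (c : List ℕ → Offspring) (i : ℕ) (w : List ℕ) :
    IsBorn c (w ++ [i]) ↔ i < (c []).1 ∧ IsBorn (fun v => c (v ++ [i])) w := by
  induction w with
  | nil => simp [IsBorn]
  | cons j w ih => simp only [List.cons_append, IsBorn, ih, and_assoc]

/-- The event that no particle of generation `n` lies to the right of `x`. -/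
def below (n : ℕ) (x : ℝ) : Set (List ℕ → Offspring) := {c | ∀ v ∈ generation c n, location c v ≤ x}

lemma mem_below_zero {c : List ℕ → Offspring} {x : ℝ} : c ∈ below 0 x ↔ 0 ≤ x := by
  constructor
  · intro h
    exact h [] ⟨rfl, trivial⟩
  · rintro h v ⟨hv, -⟩
    rw [List.length_eq_zero_iff.1 hv]
    exact h

lemma mem_below_succ {c : List ℕ → Offspring} {n : ℕ} {x : ℝ} :
    c ∈ below (n + 1) x ↔
      ∀ i < (c []).1, (fun v => c (v ++ [i])) ∈ below n (x - displacement (c []) i) := by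
  constructor
  · rintro h i hi w ⟨hw, hb⟩
    have := h (w ++ [i]) ⟨by simp [hw], (isBorn_append_singleton c i w).2 ⟨hi, hb⟩⟩
    rw [location_append_singleton] at this
    linarith
  · rintro h v ⟨hv, hb⟩
    rcases List.eq_nil_or_concat' v with rfl | ⟨w, i, rfl⟩
    · simp at hv
    · obtain ⟨hi, hb⟩ := (isBorn_append_singleton c i w).1 hb
      have := h i hi w ⟨by simpa using hv, hb⟩
      rw [location_append_singleton]
      linarith

lemma measurableSet_setOf_mem_below {α : Type*} [MeasurableSpace α] {c : α → List ℕ → Offspring}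
    {f : α → ℝ} (hc : Measurable c) (hf : Measurable f) (n : ℕ) :
    MeasurableSet {y | c y ∈ below n (f y)} := by
  have : {y | c y ∈ below n (f y)} = ⋂ v : List ℕ, ⋂ _ : v.length = n,
      (c ⁻¹' {c | IsBorn c v})ᶜ ∪ {y | location (c y) v ≤ f y} := by
    ext y
    simp only [below, generation, Set.mem_ofPred_eq, Set.mem_iInter, Set.mem_union,
      Set.mem_compl_iff, Set.mem_preimage, imp_iff_not_or]
    exact forall_congr' fun v => by tauto
  rw [this]
  exact .iInter fun v => .iInter fun _ => (hc (measurableSet_isBorn v)).compl.union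
    (measurableSet_le ((measurable_location v).comp hc) hf)

/-- A family indexed by pairs which is independent stays so when grouped along the first index. -/
lemma iIndepFun_curry {Ω ι κ β : Type*} [MeasurableSpace Ω] [MeasurableSpace β] {P : Measure Ω}
    {X : ι → κ → Ω → β} (hX : ∀ i j, Measurable (X i j))
    (h : iIndepFun (fun (p : ι × κ) ω => X p.1 p.2 ω) P) :
    iIndepFun (fun i ω j => X i j ω) P := by
  have := h.isProbabilityMeasure
  have hp : ∀ i j, IsProbabilityMeasure (P.map (X i j)) :=
    fun i j => Measure.isProbabilityMeasure_map (hX i j).aemeasurable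
  have h1 := h.map_fun_eq_infinitePi_map fun p : ι × κ => hX p.1 p.2
  rw [iIndepFun_iff_map_fun_eq_infinitePi_map fun i => measurable_pi_lambda _ (hX i)]
  have h2 : ∀ i, P.map (fun ω j => X i j ω) = Measure.infinitePi fun j => P.map (X i j) := fun i =>
    iIndepFun.map_fun_eq_infinitePi_map (hX i) (h.precomp (g := fun j => (i, j))
      fun j j' hj => (Prod.mk.inj hj).2)
  simp_rw [h2]
  rw [← Measure.infinitePi_map_curry, ← h1,
    Measure.map_map (f := fun ω (p : ι × κ) => X p.1 p.2 ω) (MeasurableEquiv.measurable _)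
      (measurable_pi_lambda _ fun p => hX p.1 p.2)]
  rfl

section Recursion

variable {Ω : Type*} [MeasurableSpace Ω] {P : Measure Ω} {ξ : List ℕ → Ω → Offspring}

lemma indepFun_root_subtrees (hm : ∀ v, Measurable (ξ v)) (hi : iIndepFun ξ P) :
    IndepFun (ξ []) (fun ω (i : ℕ) (v : List ℕ) => ξ (v ++ [i]) ω) P := by
  have h := indep_iSup_of_disjoint (fun v => (hm v).comap_le) ((iIndepFun_iff_iIndep ..).1 hi)
    (S := {[]}) (T := {[]}ᶜ) disjoint_compl_right
  rw [IndepFun_iff_Indep]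
  refine indep_of_indep_of_le_left (indep_of_indep_of_le_right h ?_) ?_
  · simp only [MeasurableSpace.pi, MeasurableSpace.comap_iSup, MeasurableSpace.comap_comp]
    exact iSup_le fun i => iSup_le fun v => le_iSup₂_of_le (v ++ [i]) (by simp) le_rfl
  · exact le_iSup₂_of_le [] rfl le_rfl

/-- Given the root's offspring, the subtrees are independent walks started one generation later. The
probability is therefore a product over the children, and the induction must range over all starting
times m. -/
theorem measure_below [IsProbabilityMeasure P] {μ : ℕ → Measure Offspring}
    [∀ n, IsProbabilityMeasure (μ n)] (n m : ℕ) {ξ : List ℕ → Ω → Offspring}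
    (hm : ∀ v, Measurable (ξ v)) (hi : iIndepFun ξ P)
    (hlaw : ∀ v, P.map (ξ v) = μ (m + v.length)) (x : ℝ) :
    P {ω | (fun v => ξ v ω) ∈ below n x} = ENNReal.ofReal (1 - maxTail μ n m x) := by
  induction n generalizing m ξ x with
  | zero =>
    simp only [mem_below_zero, maxTail]
    split_ifs with h
    · simp [not_le.2 h]
    · simp [not_lt.1 h]
  | succ n ih =>
    have hu := isTail_maxTail (μ := μ) n (m + 1)
    set T : Ω → ℕ → List ℕ → Offspring := fun ω i v => ξ (v ++ [i]) ω with hT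
    have hTm : Measurable T :=
      measurable_pi_lambda _ fun i => measurable_pi_lambda _ fun v => hm _
    have hTi : iIndepFun (fun i ω v => ξ (v ++ [i]) ω) P := by
      refine iIndepFun_curry (X := fun i v => ξ (v ++ [i])) (fun i v => hm _) ?_
      exact hi.precomp (g := fun p : ℕ × List ℕ => p.2 ++ [p.1]) fun p q hpq => by
        obtain ⟨h1, h2⟩ := List.append_inj' hpq rfl
        exact Prod.ext (by simpa using h2) h1
    have hTn : ∀ i t, P {ω | T ω i ∈ below n t} = ENNReal.ofReal (1 - maxTail μ n (m + 1) t) :=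
      fun i t => ih (m + 1) (fun v => hm _)
        (hi.precomp (g := fun v => v ++ [i]) fun v w h => (List.append_inj' h rfl).1)
        (fun v => by rw [hlaw]; congr 1; simp; ring) t
    set S : Set (Offspring × (ℕ → List ℕ → Offspring)) :=
      {q | ∀ i < q.1.1, q.2 i ∈ below n (x - displacement q.1 i)} with hS
    have hSm : MeasurableSet S := by
      have : S = ⋂ i : ℕ, {q | i < q.1.1}ᶜ ∪ {q | q.2 i ∈ below n (x - displacement q.1 i)} := by
        ext q
        simp only [hS, Set.mem_ofPred_eq, Set.mem_iInter, Set.mem_union, Set.mem_compl_iff,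
          imp_iff_not_or]
      rw [this]
      exact .iInter fun i => ((measurableSet_lt_numChildren i).preimage measurable_fst).compl.union
        (measurableSet_setOf_mem_below ((measurable_pi_apply i).comp measurable_snd)
          (measurable_const.sub ((measurable_displacement i).comp measurable_fst)) n)
    have hpre : {ω | (fun v => ξ v ω) ∈ below (n + 1) x} = (fun ω => (ξ [] ω, T ω)) ⁻¹' S := by
      ext ω
      simp only [Set.mem_ofPred_eq, mem_below_succ, Set.mem_preimage, hS, hT]
    have hroot : P.map (ξ []) = μ m := by simpa using hlaw []
    have := Measure.isProbabilityMeasure_map (μ := P) hTm.aemeasurable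
    have hmap := (indepFun_iff_map_prod_eq_prod_map_map (hm []).aemeasurable hTm.aemeasurable).1
      (indepFun_root_subtrees hm hi)
    rw [hpre, ← Measure.map_apply ((hm []).prodMk hTm) hSm, hmap, hroot, Measure.prod_apply hSm]
    have hsec : ∀ o : Offspring, P.map T (Prod.mk o ⁻¹' S) = ENNReal.ofReal
        (∏ i ∈ Finset.range o.1, (1 - maxTail μ n (m + 1) (x - displacement o i))) := fun o => by
      rw [Measure.map_apply hTm (hSm.preimage measurable_prodMk_left),
        ENNReal.ofReal_prod_of_nonneg fun i _ => sub_nonneg.2 (hu.le_one _)]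
      have : T ⁻¹' (Prod.mk o ⁻¹' S) = ⋂ i ∈ Finset.range o.1,
          {ω | T ω i ∈ below n (x - displacement o i)} := by
        ext ω; simp [hS]
      rw [this]
      refine (hTi.meas_biInter fun i _ => ⟨below n (x - displacement o i),
        measurableSet_setOf_mem_below measurable_id measurable_const n, rfl⟩).trans ?_
      exact Finset.prod_congr rfl fun i _ => hTn i _
    simp_rw [hsec]
    have hint := integrable_hit (μ := μ m) hu x
    have hint' : Integrable (fun o : Offspring =>
        ∏ i ∈ Finset.range o.1, (1 - maxTail μ n (m + 1) (x - displacement o i))) (μ m) := by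
      refine ((integrable_const (1 : ℝ)).sub hint).congr (.of_forall fun o => ?_)
      simp [hit]
    rw [← ofReal_integral_eq_lintegral_ofReal hint' (.of_forall fun o =>
      Finset.prod_nonneg fun i _ => sub_nonneg.2 (hu.le_one _))]
    congr 1
    simp only [maxTail, step]
    rw [integral_sub (integrable_const _) hint']
    simp

end Recursion

lemma exists_mem_generation {c : List ℕ → Offspring} (hc : ∀ v, 1 ≤ (c v).1) (n : ℕ) :
    (generation c n).Nonempty := by
  induction n with
  | zero => exact ⟨[], rfl, trivial⟩
  | succ n ih =>
    obtain ⟨v, hv, hb⟩ := ih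
    exact ⟨0 :: v, by simp [hv], hb, hc v⟩

/-- The hypothesis makes the generation nonempty, which excludes the default value 0 of `sSup`. -/
lemma maxLocation_le_iff {c : List ℕ → Offspring} (hc : ∀ v, 1 ≤ (c v).1) {n : ℕ} {x : ℝ} :
    maxLocation c n ≤ x ↔ c ∈ below n x := by
  unfold maxLocation
  rw [csSup_le_iff ((finite_generation c n).image _).bddAbove ((exists_mem_generation hc n).image _)]
  simp [below]

/-! ### Translation of the assumptions to the offspring laws. -/

section OffspringLaw

variable {k₀ : ℕ} {p : ℕ → ℝ} {G : (k : ℕ) → Measure (Fin k → ℝ)}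

lemma offspringLaw_eq_sum (hp : ∀ k ∉ Finset.Icc 1 k₀, p k = 0) :
    offspringLaw p G = ∑ k ∈ Finset.Icc 1 k₀,
      ENNReal.ofReal (p k) • (G k).map fun x => (⟨k, x⟩ : Offspring) := by
  ext S hS
  rw [offspringLaw, Measure.sum_apply _ hS, Measure.finsetSum_apply, tsum_eq_sum]
  intro k hk
  simp [hp k hk]

lemma ae_offspringLaw (hp : ∀ k ∉ Finset.Icc 1 k₀, p k = 0) :
    ∀ᵐ o ∂(offspringLaw p G), 1 ≤ o.1 ∧ o.1 ≤ k₀ := by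
  have hm : MeasurableSet {o : Offspring | 1 ≤ o.1 ∧ o.1 ≤ k₀} :=
    (measurableSet_le measurable_const measurable_numChildren).inter
      (measurableSet_le measurable_numChildren measurable_const)
  rw [offspringLaw_eq_sum hp, ae_iff, Measure.finsetSum_apply]
  refine Finset.sum_eq_zero fun k hk => ?_
  have hmap := Measure.map_apply (μ := G k) (measurable_sigmaMk k) hm.compl
  have : (fun x : Fin k → ℝ => (⟨k, x⟩ : Offspring)) ⁻¹' {o | ¬(1 ≤ o.1 ∧ o.1 ≤ k₀)} = ∅ := by
    ext x
    simpa using Finset.mem_Icc.1 hk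
  rw [Set.compl_def] at hmap
  change _ = G k ((fun x : Fin k → ℝ => (⟨k, x⟩ : Offspring)) ⁻¹' {o | ¬(1 ≤ o.1 ∧ o.1 ≤ k₀)}) at hmap
  rw [this, measure_empty] at hmap
  rw [Measure.smul_apply]
  exact (congrArg _ hmap).trans (smul_zero _)

lemma integral_offspringLaw (h0 : ∀ k, 0 ≤ p k) (hp : ∀ k ∉ Finset.Icc 1 k₀, p k = 0)
    {f : Offspring → ℝ} (hf : Measurable f)
    (hi : ∀ k, Integrable (fun x : Fin k → ℝ => f ⟨k, x⟩) (G k)) :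
    ∫ o, f o ∂(offspringLaw p G) = ∑ k ∈ Finset.Icc 1 k₀, p k * ∫ x, f ⟨k, x⟩ ∂(G k) := by
  rw [offspringLaw_eq_sum hp, integral_finsetSum_measure]
  · refine Finset.sum_congr rfl fun k _ => ?_
    rw [integral_smul_measure, integral_map (measurable_sigmaMk k).aemeasurable
      hf.aestronglyMeasurable, ENNReal.toReal_ofReal (h0 k), smul_eq_mul]
  · exact fun k _ => ((integrable_map_measure hf.aestronglyMeasurable
      (measurable_sigmaMk k).aemeasurable).2 (hi k)).smul_measure ENNReal.ofReal_ne_top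

variable [∀ k, IsProbabilityMeasure (G k)]

lemma integral_numChildren_offspringLaw (h0 : ∀ k, 0 ≤ p k)
    (hp : ∀ k ∉ Finset.Icc 1 k₀, p k = 0) :
    ∫ o, (o.1 : ℝ) ∂(offspringLaw p G) = ∑ k ∈ Finset.Icc 1 k₀, (k : ℝ) * p k := by
  rw [integral_offspringLaw h0 hp (f := fun o => (o.1 : ℝ))
    (measurable_from_nat.comp measurable_numChildren)
    fun k => integrable_const (k : ℝ)]
  exact Finset.sum_congr rfl fun k _ => by simp [mul_comm]

lemma farSet_offspringLaw_le (h0 : ∀ k, 0 ≤ p k) (hp : ∀ k ∉ Finset.Icc 1 k₀, p k = 0)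
    (h1 : ∑ k ∈ Finset.Icc 1 k₀, p k = 1) {B η : ℝ}
    (hG : ∀ k, p k ≠ 0 → 1 - η ≤ (G k).real {y | ∀ i, y i ≤ B} ∧
      1 - η ≤ (G k).real {y | ∀ i, -B ≤ y i}) :
    (offspringLaw p G).real (farSet B) ≤ 2 * η := by
  have e : (offspringLaw p G).real (farSet B)
      = ∑ k ∈ Finset.Icc 1 k₀, p k * (G k).real {y | ∃ i, B < |y i|} := by
    rw [← integral_indicator_one (measurableSet_farSet B), integral_offspringLaw h0 hp
      (f := (farSet B).indicator 1) (measurable_one.indicator (measurableSet_farSet B)) fun k => ?_]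
    · refine Finset.sum_congr rfl fun k _ => ?_
      have hpre : (fun x : Fin k → ℝ => (⟨k, x⟩ : Offspring)) ⁻¹' farSet B = {y | ∃ i, B < |y i|} := by
        ext y
        simp only [Set.mem_preimage, farSet, Set.mem_ofPred_eq]
        constructor
        · rintro ⟨i, hi, h⟩
          exact ⟨⟨i, hi⟩, by simpa [displacement, hi] using h⟩
        · rintro ⟨i, h⟩
          exact ⟨i, i.2, by simpa [displacement] using h⟩
      rw [← hpre, ← integral_indicator_one (measurable_sigmaMk k (measurableSet_farSet B))]
      rfl
    · exact (integrable_const (1 : ℝ)).indicator (measurable_sigmaMk k (measurableSet_farSet B))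
  rw [e]
  calc _ ≤ ∑ k ∈ Finset.Icc 1 k₀, p k * (2 * η) := Finset.sum_le_sum fun k _ => by
        rcases eq_or_ne (p k) 0 with hk | hk
        · simp [hk]
        refine mul_le_mul_of_nonneg_left ?_ (h0 k)
        obtain ⟨ha, hb⟩ := hG k hk
        have ma : MeasurableSet {y : Fin k → ℝ | ∀ i, y i ≤ B} := by
          rw [Set.ofPred_forall]
          exact .iInter fun i => measurableSet_le (measurable_pi_apply i) measurable_const
        have mb : MeasurableSet {y : Fin k → ℝ | ∀ i, -B ≤ y i} := by
          rw [Set.ofPred_forall]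
          exact .iInter fun i => measurableSet_le measurable_const (measurable_pi_apply i)
        have hsub : {y : Fin k → ℝ | ∃ i, B < |y i|}
            ⊆ {y | ∀ i, y i ≤ B}ᶜ ∪ {y | ∀ i, -B ≤ y i}ᶜ := by
          rintro y ⟨i, hi⟩
          rcases lt_abs.1 hi with h | h
          · exact Or.inl fun hy => absurd (hy i) (not_le.2 h)
          · exact Or.inr fun hy => absurd (hy i) (by linarith)
        have := (measureReal_mono (μ := G k) hsub).trans (measureReal_union_le _ _)
        rw [probReal_compl_eq_one_sub ma, probReal_compl_eq_one_sub mb] at this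
        linarith
    _ = 2 * η := by rw [← Finset.sum_mul, h1, one_mul]

lemma mul_marginalTail {k : ℕ} (hk : k ≠ 0) (μ : Measure (Fin k → ℝ)) [IsProbabilityMeasure μ]
    (x : ℝ) : k * marginalTail μ x = ∑ i, μ.real {y | x < y i} := by
  have hk' : (k : ℝ) ≠ 0 := by exact_mod_cast hk
  have : ∀ i : Fin k, μ.real {y | x < y i} = 1 - μ.real {y | y i ≤ x} := fun i => by
    rw [← probReal_compl_eq_one_sub (measurableSet_le (measurable_pi_apply i) measurable_const)]
    congr 1
    ext y
    simp
  simp_rw [this, marginalTail, marginalCDF, Finset.sum_sub_distrib]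
  rw [mul_sub, mul_div_cancel₀ _ hk']
  simp

/-- The intensity tail is a nonnegative combination of the marginal tails, so (MT2) passes to it
term by term. -/
lemma intensity_offspringLaw_Ioi [IsProbabilityMeasure (offspringLaw p G)] (h0 : ∀ k, 0 ≤ p k)
    (hp : ∀ k ∉ Finset.Icc 1 k₀, p k = 0) (x : ℝ) :
    (intensity k₀ (offspringLaw p G)).real (Set.Ioi x)
      = ∑ k ∈ Finset.Icc 1 k₀, p k * (k * marginalTail (G k) x) := by
  have hm : Measurable ((Set.Ioi x).indicator (1 : ℝ → ℝ)) :=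
    measurable_one.indicator measurableSet_Ioi
  have hb : ∀ y, |(Set.Ioi x).indicator (1 : ℝ → ℝ) y| ≤ 1 := fun y => by
    by_cases hy : y ∈ Set.Ioi x <;> simp [hy]
  have hmk : ∀ k (i : Fin k), MeasurableSet {y : Fin k → ℝ | x < y i} :=
    fun k i => measurableSet_lt measurable_const (measurable_pi_apply i)
  have hsum : ∀ k (y : Fin k → ℝ), ∑ i ∈ Finset.range k,
      (Set.Ioi x).indicator (1 : ℝ → ℝ) (displacement ⟨k, y⟩ i)
      = ∑ i : Fin k, {y : Fin k → ℝ | x < y i}.indicator (1 : (Fin k → ℝ) → ℝ) y := fun k y => by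
    rw [Finset.sum_range]
    refine Finset.sum_congr rfl fun i _ => ?_
    simp [displacement, Set.indicator_apply]
  have hint : ∀ k (i : Fin k),
      Integrable ({y : Fin k → ℝ | x < y i}.indicator (1 : (Fin k → ℝ) → ℝ)) (G k) :=
    fun k i => (integrable_const (1 : ℝ)).indicator (hmk k i)
  rw [← integral_indicator_one measurableSet_Ioi,
    integral_intensity ((ae_offspringLaw hp).mono fun o h => h.2) hm hb,
    integral_offspringLaw h0 hp
      (f := fun o => ∑ i ∈ Finset.range o.1, (Set.Ioi x).indicator (1 : ℝ → ℝ) (displacement o i))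
      (measurable_sum_range fun i => hm.comp (measurable_displacement i))]
  · refine Finset.sum_congr rfl fun k hk => ?_
    congr 1
    rw [mul_marginalTail (by have := (Finset.mem_Icc.1 hk).1; omega)]
    simp only [hsum]
    rw [integral_finsetSum _ fun i _ => hint k i]
    exact Finset.sum_congr rfl fun i _ => integral_indicator_one (hmk k i)
  · intro k
    simp only [hsum]
    exact integrable_finsetSum _ fun i _ => hint k i

end OffspringLaw

/-! ### From the window to tightness. -/

lemma isTightMeasureSet_range {ν : ℕ → Measure ℝ} [∀ n, IsFiniteMeasure (ν n)]
    (h : ∀ ε : ENNReal, 0 < ε → ∃ (J : ℕ) (A : ℝ), ∀ n, J ≤ n → ν n (Set.Icc (-A) A)ᶜ ≤ ε) :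
    IsTightMeasureSet (Set.range ν) := by
  have hfin : ∀ J, IsTightMeasureSet (ν '' Set.Iio J) := fun J => by
    induction J with
    | zero =>
      simpa using (isTightMeasureSet_singleton (μ := ν 0)).subset (Set.empty_subset _)
    | succ J ih =>
      refine (ih.union (isTightMeasureSet_singleton (μ := ν J))).subset ?_
      rintro _ ⟨n, hn, rfl⟩
      rcases (Nat.lt_succ_iff.1 hn).lt_or_eq with h | rfl
      · exact Or.inl ⟨n, h, rfl⟩
      · exact Or.inr rfl
  rw [isTightMeasureSet_iff_exists_isCompact_measure_compl_le]
  intro ε hε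
  obtain ⟨J, A, hA⟩ := h ε hε
  obtain ⟨K, hK, hKε⟩ := isTightMeasureSet_iff_exists_isCompact_measure_compl_le.1 (hfin J) ε hε
  refine ⟨K ∪ Set.Icc (-A) A, hK.union isCompact_Icc, ?_⟩
  rintro _ ⟨n, rfl⟩
  rcases lt_or_ge n J with hn | hn
  · exact (measure_mono (Set.compl_subset_compl.2 Set.subset_union_left)).trans
      (hKε _ ⟨n, hn, rfl⟩)
  · exact (measure_mono (Set.compl_subset_compl.2 Set.subset_union_right)).trans (hA n hn)

/-- If almost all the mass sits within distance `A` of `z`, then almost all of it sits within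
distance `2 * A` of any median. -/
lemma measure_compl_Icc_map_sub_median_le {F : Measure ℝ} [IsProbabilityMeasure F] {m z A : ℝ}
    {ε : ENNReal} (hm : IsMedian F m) (hε : ε < 1 / 2) (hr : F (Set.Ioi (z + A)) ≤ ε)
    (hl : F (Set.Iic (z - A)) ≤ ε) :
    F.map (fun x => x - m) (Set.Icc (-(2 * A)) (2 * A))ᶜ ≤ 2 * ε := by
  have h1 : z - A ≤ m := by
    by_contra h
    exact absurd ((hm.1.trans (measure_mono (Set.Iic_subset_Iic.2 (not_le.1 h).le))).trans hl)
      (not_le.2 hε)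
  have h2 : m ≤ z + A := by
    by_contra h
    exact absurd ((hm.2.trans (measure_mono (Set.Ici_subset_Ioi.2 (not_le.1 h)))).trans hr)
      (not_le.2 hε)
  rw [Measure.map_apply (f := fun x => x - m) (measurable_id.sub_const m) measurableSet_Icc.compl, two_mul ε]
  refine (measure_mono ?_).trans ((measure_union_le _ _).trans (add_le_add hr hl))
  intro x hx
  by_contra hcon
  simp only [Set.mem_union, Set.mem_Ioi, Set.mem_Iic, not_or, not_lt, not_le] at hcon
  exact hx ⟨by linarith, by linarith⟩

lemma IsGBRW.maxLaw_Iic {p : ℕ → ℕ → ℝ} {G : (n k : ℕ) → Measure (Fin k → ℝ)} {Ω : Type*}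
    [MeasurableSpace Ω] {P : Measure Ω} [IsProbabilityMeasure P] {ξ : List ℕ → Ω → Offspring}
    (hξ : IsGBRW p G P ξ) [∀ n, IsProbabilityMeasure (offspringLaw (p n) (G n))]
    (hK : ∀ n, ∀ᵐ o ∂(offspringLaw (p n) (G n)), 1 ≤ o.1) (n : ℕ) (x : ℝ) :
    maxLaw P ξ n (Set.Iic x)
      = ENNReal.ofReal (1 - maxTail (fun n => offspringLaw (p n) (G n)) n 0 x) := by
  have hm : Measurable fun ω v => ξ v ω := measurable_pi_lambda _ hξ.measurable
  rw [maxLaw, Measure.map_apply (f := fun ω => maxLocation (fun v => ξ v ω) n)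
      ((measurable_maxLocation n).comp hm) measurableSet_Iic,
    ← measure_below (μ := fun n => offspringLaw (p n) (G n)) n 0 hξ.measurable hξ.indep
      (fun v => by rw [hξ.law, zero_add]) x]
  have hall : ∀ᵐ ω ∂P, ∀ v, 1 ≤ (ξ v ω).1 := by
    rw [ae_all_iff]
    intro v
    have := hK v.length
    rw [← hξ.law v] at this
    exact ae_of_ae_map (hξ.measurable v).aemeasurable this
  refine measure_congr ?_
  filter_upwards [hall] with ω hω
  exact propext (maxLocation_le_iff hω)

end GBRW

end

theorem theorem1
    -- the branching rules and the joint displacement laws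
    (p : ℕ → ℕ → ℝ) (hp : GBRW.IsBranchingRule p)
    (G : (n k : ℕ) → MeasureTheory.Measure (Fin k → ℝ))
    [∀ n k, MeasureTheory.IsProbabilityMeasure (G n k)]
    -- the walk
    {Ω : Type*} [MeasurableSpace Ω] (P : MeasureTheory.Measure Ω)
    [MeasureTheory.IsProbabilityMeasure P]
    (ξ : List ℕ → Ω → GBRW.Offspring) (hξ : GBRW.IsGBRW p G P ξ)
    -- (B1) uniformly bounded offspring number
    (k₀ : ℕ) (hk₀ : 1 < k₀) (B1 : ∀ n k, k ∉ Finset.Icc 1 k₀ → p n k = 0)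
    -- (B2) mean offspring number uniformly above `m₀ > 1`
    (m₀ : ℝ) (hm₀ : 1 < m₀) (B2 : m₀ < ⨅ n, ∑ k ∈ Finset.Icc 1 k₀, (k : ℝ) * p n k)
    -- (MT1) not too much mass of the marginals drifts to `-∞`
    (ε₀ : ℝ) (hε₀ : ε₀ < min (1 / 4 * Real.log m₀) 1) (x₀ : ℝ)
    (MT1 : ∀ n k, p n k ≠ 0 → 1 - ε₀ ≤ GBRW.marginalTail (G n k) x₀)
    -- (MT2) uniform exponential decay of the right tails of the marginals
    (a : ℝ) (ha : 0 < a) (M₀ : ℝ) (hM₀ : 0 < M₀)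
    (MT2 : ∀ n k, p n k ≠ 0 → ∀ M x : ℝ, M₀ < M → 0 ≤ x →
      GBRW.marginalTail (G n k) (x + M) ≤ Real.exp (-a * M) * GBRW.marginalTail (G n k) x)
    -- (GT) uniform tightness of the joint displacement laws
    (GT : ∀ η : ℝ, 0 < η → ∃ B : ℝ, 0 < B ∧ ∀ n k, p n k ≠ 0 →
      1 - η ≤ (G n k).real {y | ∀ i, y i ≤ B} ∧ 1 - η ≤ (G n k).real {y | ∀ i, -B ≤ y i})
    -- any choice of medians
    (med : ℕ → ℝ) (hmed : ∀ n, GBRW.IsMedian (GBRW.maxLaw P ξ n) (med n)) :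
    MeasureTheory.IsTightMeasureSet
      (Set.range fun n => (GBRW.maxLaw P ξ n).map fun x => x - med n) := by
  have hprob : ∀ n, IsProbabilityMeasure (GBRW.offspringLaw (p n) (G n)) := fun n => by
    -- Any label of length n will do: its offspring vector has the law in question.
    have := Measure.isProbabilityMeasure_map (μ := P) (hξ.measurable (List.replicate n 0)).aemeasurable
    rwa [hξ.law, List.length_replicate] at this
  have hsum : ∀ n, ∑ k ∈ Finset.Icc 1 k₀, p n k = 1 := fun n =>
    (hasSum_sum_of_ne_finset_zero fun k hk => B1 n k hk).unique (hp.hasSum n)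
  -- The excess of the mean is capped at 1 because the contraction estimates require s ≤ 1.
  have hunif : GBRW.UniformOffspring k₀ (min (m₀ - 1) 1) a M₀
      fun n => GBRW.offspringLaw (p n) (G n) := by
    refine ⟨hprob, fun n => GBRW.ae_offspringLaw (B1 n), fun n => ?_, fun η hη => ?_,
      fun n M x hM hx => ?_⟩
    · rw [GBRW.integral_numChildren_offspringLaw (hp.nonneg n) (B1 n)]
      have hbdd : BddBelow (Set.range fun n => ∑ k ∈ Finset.Icc 1 k₀, (k : ℝ) * p n k) :=
        ⟨0, by
          rintro _ ⟨n, rfl⟩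
          exact Finset.sum_nonneg fun k _ => mul_nonneg k.cast_nonneg (hp.nonneg n k)⟩
      linarith [ciInf_le hbdd n, min_le_left (m₀ - 1) 1]
    · obtain ⟨B, -, hB⟩ := GT (η / 2) (half_pos hη)
      refine ⟨B, fun n => ?_⟩
      have := GBRW.farSet_offspringLaw_le (hp.nonneg n) (B1 n) (hsum n) (hB n)
      linarith
    · have := hprob n
      rw [GBRW.intensity_offspringLaw_Ioi (hp.nonneg n) (B1 n),
        GBRW.intensity_offspringLaw_Ioi (hp.nonneg n) (B1 n), Finset.mul_sum]
      refine Finset.sum_le_sum fun k _ => ?_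
      rcases eq_or_ne (p n k) 0 with hk | hk
      · simp [hk]
      · have := mul_le_mul_of_nonneg_left (MT2 n k hk M x hM hx)
          (mul_nonneg (hp.nonneg n k) k.cast_nonneg)
        linarith
  have hFm : ∀ n, Measurable fun ω => GBRW.maxLocation (fun v => ξ v ω) n := fun n =>
    (GBRW.measurable_maxLocation n).comp (measurable_pi_lambda _ hξ.measurable)
  have hF : ∀ n, IsProbabilityMeasure (GBRW.maxLaw P ξ n) := fun n =>
    Measure.isProbabilityMeasure_map (hFm n).aemeasurable
  have hIic := hξ.maxLaw_Iic fun n => (hunif.bound n).mono fun o h => h.1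
  refine GBRW.isTightMeasureSet_range fun ε hε => ?_
  -- Each side of the window loses mass δ, and δ < 1/2 forces the median into the window.
  obtain ⟨δ, hδ0, hδε, hδ1⟩ : ∃ δ : ℝ, 0 < δ ∧ 2 * ENNReal.ofReal δ ≤ ε ∧ δ ≤ 1 / 4 := by
    obtain ⟨r, hr0, hrε⟩ := ENNReal.lt_iff_exists_nnreal_btwn.1 hε
    have hr : 0 < (r : ℝ) := by exact_mod_cast hr0
    refine ⟨min (r / 2) (1 / 4), lt_min (half_pos hr) (by norm_num), ?_, min_le_right _ _⟩
    calc 2 * ENNReal.ofReal (min (r / 2) (1 / 4)) ≤ 2 * ENNReal.ofReal (r / 2) := by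
          gcongr; exact min_le_left _ _
      _ = ENNReal.ofReal (2 * (r / 2)) := by rw [ENNReal.ofReal_mul (by norm_num)]; simp
      _ = r := by rw [mul_div_cancel₀ _ two_ne_zero, ENNReal.ofReal_coe_nnreal]
      _ ≤ ε := hrε.le
  obtain ⟨J, A, hJ⟩ := hunif.exists_window hk₀.le (lt_min (by linarith) one_pos)
    (min_le_right _ _) ha hδ0 (by linarith)
  refine ⟨J, 2 * A, fun n hn => ?_⟩
  obtain ⟨z, hz1, hz2⟩ := hJ (n - J) 0
  rw [Nat.sub_add_cancel hn] at hz1 hz2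
  refine (GBRW.measure_compl_Icc_map_sub_median_le (hmed n) (z := z) (ε := ENNReal.ofReal δ)
    ?_ ?_ ?_).trans hδε
  · rw [← ENNReal.ofReal_one, ← ENNReal.ofReal_ofNat 2, ← ENNReal.ofReal_div_of_pos (by norm_num)]
    exact (ENNReal.ofReal_lt_ofReal_iff (by norm_num)).2 (by linarith)
  · rw [← Set.compl_Iic, prob_compl_eq_one_sub measurableSet_Iic, hIic, ← ENNReal.ofReal_one,
      ← ENNReal.ofReal_sub _ (sub_nonneg.2 ((GBRW.isTail_maxTail n 0).le_one _))]
    exact ENNReal.ofReal_le_ofReal (by linarith)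
  · rw [hIic]
    exact ENNReal.ofReal_le_ofReal (by linarith)
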